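/- For a string $S=S[1]\cdots S[n]$ and disjoint intervals $L,R\subseteq\{1,\dots,n\}$, an $L$-$R$-$3$-cadence is a pair of integers $(i,d)$ with $d>0$, $i\in L$, $i+2d\in R$ and $S[i]=S[i+d]=S[i+2d]$. The $L$-$R$-$3$-cadence detection problem asks, given $S$ and the endpoints of two disjoint nonempty intervals $L,R\subseteq\{1,\dots,n\}$, whether $S$ has an $L$-$R$-$3$-cadence. A string is grammar-compressed if it is given by a straight-line grammar in Chomsky normal form, that is, by an ordered list $v_1,\dots,v_m$ of nonterminals such that the right-hand side of each $v_i$ is either a character or of the form $v_jv_k$ with $j,k<i$, the start symbol being $v_m$. Its compressed size is $m$. Algorithms are programs of a random access machine with words of $w$ bits, on which reading and writing registers and array cells, addition, subtraction, halving and comparison take one step each. The input is in the memory at the start. 1. The $L$-$R$-$3$-cadence detection problem for grammar-compressed binary strings can be solved in time polynomial in the compressed size and in $\max\left(\frac{|L|}{|R|},\frac{|R|}{|L|}\right)$: there are a program and a polynomial in these two quantities that bounds, on every input, both the number of steps and the word length $w$ that suffices for the run. 2. The $L$-$R$-$3$-cadence detection problem for uncompressed binary strings can be solved in time linear in $|L|+|R|$: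 there are a program and a constant $c$ such that on every input the program halts with the correct answer after at most $c\,(|L|+|R|)$ steps, with words of $w=O(1+\log n)$ bits. -/

import Mathlib

/-! ### Strings, sub-cadences and `L`-`R`-`k`-cadences -/

/-- The character `S[i]` of a string, with indices `1, …, n`; it is `none` outside this range. -/
def charAt {α : Type*} (S : List α) (i : ℕ) : Option α :=
  if i = 0 then none else S[i - 1]?

/-- `(i, d, k)` is a `k`-sub-cadence of `S`: `d > 0`, all of `i, i + d, …, i + (k - 1) d` are
indices of `S`, and they carry one and the same character. -/
def IsSubCadence {α : Type*} (S : List α) (i d k : ℕ) : Prop :=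
  0 < d ∧ ∃ c : α, ∀ j < k, charAt S (i + j * d) = some c

/-- `(i, d, k)` is an `L`-`R`-`k`-cadence of `S`: a `k`-sub-cadence that starts in `L` and ends
in `R`. -/
def IsLRCadence {α : Type*} (S : List α) (L R : Finset ℕ) (i d k : ℕ) : Prop :=
  IsSubCadence S i d k ∧ i ∈ L ∧ i + (k - 1) * d ∈ R

/-- The question of the decision problem of `L`-`R`-`k`-cadence detection. -/
def HasLRCadence {α : Type*} (S : List α) (L R : Finset ℕ) (k : ℕ) : Prop :=
  ∃ i d : ℕ, IsLRCadence S L R i d k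

/-- Two disjoint nonempty intervals of indices of a string of length `n`, given by their
endpoints. Neither of the two is required to be the left one. -/
structure IntervalPair (n : ℕ) where
  lmin : ℕ
  lmax : ℕ
  rmin : ℕ
  rmax : ℕ
  one_le_lmin : 1 ≤ lmin
  lmin_le_lmax : lmin ≤ lmax
  lmax_le : lmax ≤ n
  one_le_rmin : 1 ≤ rmin
  rmin_le_rmax : rmin ≤ rmax
  rmax_le : rmax ≤ n
  disj : Disjoint (Finset.Icc lmin lmax) (Finset.Icc rmin rmax)

/-- The interval `L`. -/
def IntervalPair.L {n : ℕ} (I : IntervalPair n) : Finset ℕ := Finset.Icc I.lmin I.lmax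

/-- The interval `R`. -/
def IntervalPair.R {n : ℕ} (I : IntervalPair n) : Finset ℕ := Finset.Icc I.rmin I.rmax

/-! ### Grammar-compressed strings -/

/-- A straight-line grammar in Chomsky normal form with nonterminals `v_0, …, v_{size - 1}`: the
right-hand side of `v_i` is a character or a pair `v_j v_k` with `j, k < i`. The start symbol is
the last nonterminal. -/
structure StraightLineGrammar (α : Type*) where
  /-- The number of nonterminals, i.e. the compressed size. -/
  size : ℕ
  size_pos : 0 < size
  rhs : (i : Fin size) → α ⊕ (Fin i.val × Fin i.val)

/-- The string derived from the nonterminal `v_i`. -/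
def StraightLineGrammar.expand {α : Type*} (G : StraightLineGrammar α) (i : Fin G.size) :
    List α :=
  match G.rhs i with
  | .inl a => [a]
  | .inr (j, k) =>
      G.expand ⟨j.val, j.isLt.trans i.isLt⟩ ++ G.expand ⟨k.val, k.isLt.trans i.isLt⟩
termination_by i.val

/-- The string given by the grammar. -/
def StraightLineGrammar.word {α : Type*} (G : StraightLineGrammar α) : List α :=
  G.expand ⟨G.size - 1, Nat.sub_lt G.size_pos Nat.one_pos⟩

/-! ### Random access machines

A program is a finite while-program over registers and random access arrays of natural numbers.
It mentions finitely many registers and arrays. Every elementary operation (reading a register or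
an array cell, addition, truncated subtraction, halving, comparison, writing, testing) costs one
step. There is no multiplication. A run with word length `w` is one in which every number that is
read, computed, written or used as an address is less than `2 ^ w`. -/

namespace WordRAM

/-- The contents of the registers and of the arrays. -/
structure State where
  reg : ℕ → ℕ
  arr : ℕ → ℕ → ℕ

/-- Write `v` to register `x`. -/
def State.setReg (s : State) (x v : ℕ) : State where
  reg := Function.update s.reg x v
  arr := s.arr

/-- Write `v` to the cell of array `a` with address `i`. -/
def State.setCell (s : State) (a i v : ℕ) : State where
  reg := s.reg
  arr := Function.update s.arr a (Function.update (s.arr a) i v)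

/-- Expressions: constants, registers, array cells, sum, truncated difference, half (rounded
down), and comparison. -/
inductive Expr where
  | const (c : ℕ)
  | var (x : ℕ)
  | get (a : ℕ) (e : Expr)
  | add (e f : Expr)
  | sub (e f : Expr)
  | half (e : Expr)
  | lt (e f : Expr)

/-- The value of an expression. -/
def Expr.eval (s : State) : Expr → ℕ
  | .const c => c
  | .var x => s.reg x
  | .get a e => s.arr a (e.eval s)
  | .add e f => e.eval s + f.eval s
  | .sub e f => e.eval s - f.eval s
  | .half e => e.eval s / 2
  | .lt e f => if e.eval s < f.eval s then 1 else 0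

/-- The number of elementary operations in the evaluation of an expression. -/
def Expr.cost : Expr → ℕ
  | .const _ => 1
  | .var _ => 1
  | .get _ e => e.cost + 1
  | .add e f => e.cost + f.cost + 1
  | .sub e f => e.cost + f.cost + 1
  | .half e => e.cost + 1
  | .lt e f => e.cost + f.cost + 1

/-- All values that occur in the evaluation of an expression are less than `2 ^ w`. -/
def Expr.Fits (w : ℕ) (s : State) : Expr → Prop
  | .const c => c < 2 ^ w
  | .var x => s.reg x < 2 ^ w
  | .get a e => e.Fits w s ∧ s.arr a (e.eval s) < 2 ^ w
  | .add e f => e.Fits w s ∧ f.Fits w s ∧ e.eval s + f.eval s < 2 ^ w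
  | .sub e f => e.Fits w s ∧ f.Fits w s
  | .half e => e.Fits w s
  | .lt e f => e.Fits w s ∧ f.Fits w s ∧ 1 < 2 ^ w

/-- Programs. `assign x e` writes to register `x`, `store a e f` writes the value of `f` to the
cell of array `a` whose address is the value of `e`; `loop e p` is `while e do p`. A test succeeds if
its value is nonzero. -/
inductive Prog where
  | skip
  | assign (x : ℕ) (e : Expr)
  | store (a : ℕ) (e f : Expr)
  | seq (p q : Prog)
  | ite (e : Expr) (p q : Prog)
  | loop (e : Expr) (p : Prog)

/-- `Exec w p s t s'`: the program `p`, started in `s`, halts in `s'` after exactly `t` steps, and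
its run has word length `w`. -/
inductive Exec (w : ℕ) : Prog → State → ℕ → State → Prop
  | skip (s : State) : Exec w .skip s 1 s
  | assign (x : ℕ) (e : Expr) (s : State) (he : e.Fits w s) :
      Exec w (.assign x e) s (e.cost + 1)
        (s.setReg x (e.eval s))
  | store (a : ℕ) (e f : Expr) (s : State) (he : e.Fits w s) (hf : f.Fits w s) :
      Exec w (.store a e f) s (e.cost + f.cost + 1)
        (s.setCell a (e.eval s) (f.eval s))
  | seq (p q : Prog) (s s' s'' : State) (t t' : ℕ)
      (hp : Exec w p s t s') (hq : Exec w q s' t' s'') :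
      Exec w (.seq p q) s (t + t') s''
  | iteTrue (e : Expr) (p q : Prog) (s s' : State) (t : ℕ)
      (he : e.Fits w s) (h : e.eval s ≠ 0) (hp : Exec w p s t s') :
      Exec w (.ite e p q) s (e.cost + 1 + t) s'
  | iteFalse (e : Expr) (p q : Prog) (s s' : State) (t : ℕ)
      (he : e.Fits w s) (h : e.eval s = 0) (hq : Exec w q s t s') :
      Exec w (.ite e p q) s (e.cost + 1 + t) s'
  | loopTrue (e : Expr) (p : Prog) (s s' s'' : State) (t t' : ℕ)
      (he : e.Fits w s) (h : e.eval s ≠ 0) (hp : Exec w p s t s')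
      (hw : Exec w (.loop e p) s' t' s'') :
      Exec w (.loop e p) s (e.cost + 1 + t + t') s''
  | loopFalse (e : Expr) (p : Prog) (s : State)
      (he : e.Fits w s) (h : e.eval s = 0) :
      Exec w (.loop e p) s (e.cost + 1) s

/-- Started in `s`, the program halts within `T` steps on words of `w` bits, and register `0` is
then nonzero if the answer is yes and zero if it is no. -/
def Decides (p : Prog) (s : State) (answer : Prop) (T w : ℕ) : Prop :=
  ∃ (t : ℕ) (s' : State), Exec w p s t s' ∧ t ≤ T ∧ (s'.reg 0 ≠ 0 ↔ answer)

end WordRAM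

/-! ### The inputs of the two decision problems -/

/-- The registers at the start: a number (the length of the string or the number of nonterminals)
and the endpoints of the two intervals; all other registers are zero. -/
def inputRegs {n : ℕ} (m : ℕ) (I : IntervalPair n) (x : ℕ) : ℕ :=
  [m, I.lmin, I.lmax, I.rmin, I.rmax].getD x 0

/-- Uncompressed input: the cell `i` of array `0` holds `S[i]` for `1 ≤ i ≤ n`; all other cells
are zero. -/
def stringInput (S : List Bool) (I : IntervalPair S.length) : WordRAM.State where
  reg := inputRegs S.length I
  arr := fun a i => if a = 0 ∧ charAt S i = some true then 1 else 0

/-- Compressed input: the cells `i < size` of the arrays `0, 1, 2` hold `b, 0, 0` if the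
right-hand side of `v_i` is the character `b`, and `2, j, k` if it is `v_j v_k`; all other cells
are zero. -/
def grammarInput (G : StraightLineGrammar Bool) (I : IntervalPair G.word.length) :
    WordRAM.State where
  reg := inputRegs G.size I
  arr := fun a i =>
    if h : i < G.size then
      match G.rhs ⟨i, h⟩ with
      | .inl b => [b.toNat].getD a 0
      | .inr (j, k) => [2, j.val, k.val].getD a 0
    else 0

/-!
Fix a parity and let `x`, `y` be the restrictions of the string to the indices of that parity in
`L` and in `R`. A cadence is a pair of an index `i` of `x` and an index `j` of `y` that carry the
same character as their midpoint `(i + j) / 2`. The strings are binary, and this makes the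
structure of cadence-free strings rigid: if `x` changes from `u` to `v` somewhere and `y` changes
from `v` to `u` somewhere, then the pairs `(u, u)` and `(v, v)` at these two changes have the same
midpoint, and one of them is a cadence (`hasClassCadence_of_opposite_changes`). So there is a
cadence unless one of `x` and `y` is constant, or both change their character exactly once and in
the same direction.

* In the last case the pairs of equal characters have their midpoints in two intervals, and the
  first or last occurrences of the characters decide (`not_hasClassCadence_of_one_change`,
  `hasClassCadence_of_const_const`).
* If `x` is constantly `c`, then a right index `j` with character `c` is part of a cadence iff `c`
  occurs in a window of midpoints of the length of `x`. The algorithm takes the next such `j` and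
  the next occurrence `m` of `c` behind the start of its window. If `m` is not in the window, it
  passes on to the first `j` whose window contains `m`. From then on each round either ends the
  search or advances by the length of `x`, so that the number of rounds is bounded by the ratio of
  the lengths (`WordRAM.run_constLoop`).

This algorithm, `WordRAM.detect`, reads the string only through searches for the next occurrence
of a character among the indices of step `1` or `2`. Its correctness and its running time, in terms
of the number of rounds and the cost of the searches, are `WordRAM.run_detect`. In an uncompressed
string the search is a linear scan, and the scans of all rounds together cover `L`, `R` and the
midpoints a bounded number of times (`exists_linear_prog`). In a grammar-compressed string, tables
of the lengths and of the first occurrences of the two characters at odd and at even indices are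
computed for all nonterminals, and a search is one descent in the derivation tree
(`WordRAM.run_descend`), which takes linear time in the size of the grammar
(`exists_polynomial_prog`).

The registers `0, …, 4` hold the input, `9` the answer, `10, …, 18` belong to the detection
algorithm, `20, …, 23` hold the arguments and the result of a search, and the higher registers
belong to the search programs.
-/

namespace WordRAM

/-! ### Runs of programs -/

/-- Total correctness with running time: started in `s`, the program `p` halts on words of `w`
bits, and its number of steps and its final state satisfy `Q`. -/
def Run (w : ℕ) (p : Prog) (s : State) (Q : ℕ → State → Prop) : Prop :=
  ∃ t s', Exec w p s t s' ∧ Q t s'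

@[simp] theorem setReg_reg (s : State) (x v y : ℕ) :
    (s.setReg x v).reg y = if y = x then v else s.reg y := by
  simp [State.setReg, Function.update_apply]

@[simp] theorem setReg_arr (s : State) (x v : ℕ) : (s.setReg x v).arr = s.arr := rfl

@[simp] theorem setCell_reg (s : State) (a i v : ℕ) : (s.setCell a i v).reg = s.reg := rfl

@[simp] theorem setCell_arr (s : State) (a i v b j : ℕ) :
    (s.setCell a i v).arr b j = if b = a ∧ j = i then v else s.arr b j := by
  by_cases hb : b = a
  · subst hb
    simp [State.setCell, Function.update_apply]
  · simp [State.setCell, hb]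

variable {w : ℕ} {p q : Prog} {s : State} {Q Q' : ℕ → State → Prop} {e f : Expr} {a x : ℕ}

theorem Run.mono (h : Run w p s Q) (hQ : ∀ t s', Q t s' → Q' t s') : Run w p s Q' := by
  obtain ⟨t, s', h, hq⟩ := h
  exact ⟨t, s', h, hQ _ _ hq⟩

theorem Run.skip (h : Q 1 s) : Run w .skip s Q := ⟨_, _, .skip s, h⟩

theorem Run.assign (he : e.Fits w s) (h : Q (e.cost + 1) (s.setReg x (e.eval s))) :
    Run w (.assign x e) s Q := ⟨_, _, .assign x e s he, h⟩

theorem Run.store (he : e.Fits w s) (hf : f.Fits w s)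
    (h : Q (e.cost + f.cost + 1) (s.setCell a (e.eval s) (f.eval s))) :
    Run w (.store a e f) s Q := ⟨_, _, .store a e f s he hf, h⟩

theorem Run.seq (h : Run w p s fun t s' => Run w q s' fun t' s'' => Q (t + t') s'') :
    Run w (.seq p q) s Q := by
  obtain ⟨t, s', hp, t', s'', hq, h⟩ := h
  exact ⟨_, _, .seq _ _ _ _ _ _ _ hp hq, h⟩

theorem Run.ite (he : e.Fits w s)
    (h₁ : e.eval s ≠ 0 → Run w p s fun t s' => Q (e.cost + 1 + t) s')
    (h₂ : e.eval s = 0 → Run w q s fun t s' => Q (e.cost + 1 + t) s') :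
    Run w (.ite e p q) s Q := by
  by_cases h : e.eval s = 0
  · obtain ⟨t, s', hq, h'⟩ := h₂ h
    exact ⟨_, _, .iteFalse _ _ _ _ _ _ he h hq, h'⟩
  · obtain ⟨t, s', hq, h'⟩ := h₁ h
    exact ⟨_, _, .iteTrue _ _ _ _ _ _ he h hq, h'⟩

theorem Run.loop (he : e.Fits w s)
    (h₁ : e.eval s ≠ 0 → Run w p s fun t s' => Run w (.loop e p) s' fun t' s'' =>
      Q (e.cost + 1 + t + t') s'')
    (h₂ : e.eval s = 0 → Q (e.cost + 1) s) :
    Run w (.loop e p) s Q := by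
  by_cases h : e.eval s = 0
  · exact ⟨_, _, .loopFalse _ _ _ he h, h₂ h⟩
  · obtain ⟨t, s', hp, t', s'', hq, h'⟩ := h₁ h
    exact ⟨_, _, .loopTrue _ _ _ _ _ _ _ he h hp hq, h'⟩

/-- The remainder modulo `2`. -/
def Expr.mod2 (e : Expr) : Expr := .sub e (.add (.half e) (.half e))

theorem Expr.eval_mod2 (e : Expr) (s : State) : e.mod2.eval s = e.eval s % 2 := by
  simp only [Expr.mod2, Expr.eval]
  omega

theorem Expr.cost_mod2 (e : Expr) : e.mod2.cost = 3 * e.cost + 4 := by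
  simp only [Expr.mod2, Expr.cost]
  omega

theorem Expr.fits_mod2 {e : Expr} (h : e.Fits w s) (h' : e.eval s < 2 ^ w) :
    e.mod2.Fits w s := by
  simp only [Expr.mod2, Expr.Fits]
  exact ⟨h, h, h, by simp only [Expr.eval]; omega⟩

end WordRAM

/-! ### The combinatorics of one parity class -/

/-- `r` is the first index `≥ a` of the residue class of `a` modulo `k` at which `bit` has the
value `c`, as far as the indices `≤ b` are concerned: if there is no such index up to `b`, then
`r` may be any number above `b`. -/
structure IsNext (bit : ℕ → ℕ) (k c a b r : ℕ) : Prop where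
  le : a ≤ r
  none : ∀ x, a ≤ x → x < r → x ≤ b → x % k = a % k → bit x ≠ c
  hit : r ≤ b → bit r = c ∧ r % k = a % k

/-- Some `i ∈ [i₀, i₁]` and `j ∈ [j₀, j₁]`, of the parities of `i₀` and `j₀`, carry the same
character as their midpoint. -/
def HasClassCadence (bit : ℕ → ℕ) (i₀ i₁ j₀ j₁ : ℕ) : Prop :=
  ∃ i j, i₀ ≤ i ∧ i ≤ i₁ ∧ j₀ ≤ j ∧ j ≤ j₁ ∧ i % 2 = i₀ % 2 ∧ j % 2 = j₀ % 2 ∧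
    bit i = bit j ∧ bit ((i + j) / 2) = bit i

section Classes

variable {bit : ℕ → ℕ} {i₀ i₁ j₀ j₁ : ℕ}

theorem HasClassCadence.swap (h : HasClassCadence bit i₀ i₁ j₀ j₁) :
    HasClassCadence bit j₀ j₁ i₀ i₁ := by
  obtain ⟨i, j, h1, h2, h3, h4, h5, h6, h7, h8⟩ := h
  exact ⟨j, i, h3, h4, h1, h2, h6, h5, h7.symm, by rw [add_comm, h8, h7]⟩

theorem hasClassCadence_comm :
    HasClassCadence bit i₀ i₁ j₀ j₁ ↔ HasClassCadence bit j₀ j₁ i₀ i₁ :=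
  ⟨.swap, .swap⟩

/-- Opposite changes of character, `u, v` at consecutive indices `a, a + 2` of the left class and
`v, u` at consecutive indices `b, b + 2` of the right class, force a cadence: the pairs
`(a, b + 2)` and `(a + 2, b)` have the same midpoint, which carries `u` or `v`. -/
theorem hasClassCadence_of_opposite_changes (hbit : ∀ x, bit x ≤ 1) {a b : ℕ}
    (ha₀ : i₀ ≤ a) (ha₁ : a + 2 ≤ i₁) (hb₀ : j₀ ≤ b) (hb₁ : b + 2 ≤ j₁)
    (ha : a % 2 = i₀ % 2) (hb : b % 2 = j₀ % 2)
    (h₁ : bit a = bit (b + 2)) (h₂ : bit (a + 2) = bit b) (h₃ : bit a ≠ bit (a + 2)) :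
    HasClassCadence bit i₀ i₁ j₀ j₁ := by
  have e1 : (a + (b + 2)) / 2 = (a + b) / 2 + 1 := by omega
  have e2 : (a + 2 + b) / 2 = (a + b) / 2 + 1 := by omega
  have := hbit a
  have := hbit (a + 2)
  have := hbit ((a + b) / 2 + 1)
  by_cases h : bit ((a + b) / 2 + 1) = bit a
  · exact ⟨a, b + 2, by omega, by omega, by omega, by omega, by omega, by omega, h₁,
      by rw [e1, h]⟩
  · exact ⟨a + 2, b, by omega, by omega, by omega, by omega, by omega, by omega, h₂,
      by rw [e2]; omega⟩

/-- The index before the first occurrence of the other character carries the old one. -/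
theorem IsNext.before (hbit : ∀ x, bit x ≤ 1) {a b c r : ℕ} (hc : c ≤ 1)
    (h : IsNext bit 2 (1 - c) a b r) (hr : r ≤ b) (hac : bit a = c) :
    a + 2 ≤ r ∧ bit (r - 2) = c ∧ r % 2 = a % 2 ∧ bit r = 1 - c := by
  obtain ⟨h1, h2⟩ := h.hit hr
  have h3 := h.le
  have h4 : r ≠ a := by rintro rfl; omega
  have h5 := h.none (r - 2) (by omega) (by omega) (by omega) (by omega)
  have := hbit (r - 2)
  exact ⟨by omega, by omega, h2, h1⟩

theorem IsNext.eval_char (hbit : ∀ x, bit x ≤ 1) {a r : ℕ} (h : IsNext bit 2 1 a a r) :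
    (if r < a + 1 then 1 else 0) = bit a := by
  have := hbit a
  have h1 := h.le
  split_ifs with h2
  · obtain rfl : r = a := by omega
    exact (h.hit le_rfl).1.symm
  · have := h.none a le_rfl (by omega) le_rfl rfl
    omega

/-- The search for the other character fails on a constant class only. -/
theorem IsNext.const (hbit : ∀ x, bit x ≤ 1) {a b c r : ℕ} (hc : c ≤ 1)
    (h : IsNext bit 2 (1 - c) a b r) (hr : b < r) :
    ∀ x, a ≤ x → x ≤ b → x % 2 = a % 2 → bit x = c := fun x h1 h2 h3 => by
  have := h.none x h1 (by omega) h2 h3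
  have := hbit x
  omega

/-- If the left class is constantly `c`, then a right index `j` with character `c` belongs to a
cadence as soon as `c` occurs between the midpoints of `j` with the two ends of the left class. -/
theorem hasClassCadence_of_const {c i j m : ℕ} (hi : i₁ % 2 = i₀ % 2) (hj : j₀ % 2 = i₀ % 2)
    (hconst : ∀ x, i₀ ≤ x → x ≤ i₁ → x % 2 = i₀ % 2 → bit x = c)
    (hj₀ : j₀ ≤ j) (hj₁ : j ≤ j₁) (hjp : j % 2 = j₀ % 2) (hjc : bit j = c)
    (hm₀ : (i₀ + j) / 2 ≤ m) (hm₁ : m ≤ (i₁ + j) / 2) (hm : bit m = c) (hi' : i = 2 * m - j) :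
    HasClassCadence bit i₀ i₁ j₀ j₁ := by
  have hii := hconst i (by omega) (by omega) (by omega)
  refine ⟨i, j, by omega, by omega, hj₀, hj₁, by omega, hjp, by omega, ?_⟩
  rw [show (i + j) / 2 = m by omega, hm, hii]

end Classes

namespace WordRAM

/-! ### Detection with a search oracle -/

/-- The program `q` searches: with start, end and character in the registers `20, 21, 22` it
leaves in register `23` the first index of the residue class modulo `k` of the start that carries
the character (or a number above the end). It keeps the arrays `A` and the registers below `20`,
and takes at most `κ₀` steps plus `κ₁` steps for each index passed over. -/
def Searches (w n z : ℕ) (A : ℕ → ℕ → ℕ) (bit : ℕ → ℕ) (κ₀ κ₁ k : ℕ) (q : Prog) : Prop :=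
  ∀ s : State, s.arr = A → s.reg 0 = z → 1 ≤ s.reg 20 → s.reg 20 ≤ s.reg 21 → s.reg 21 ≤ n →
    s.reg 22 ≤ 1 → Run w q s fun t s' => s'.arr = A ∧ (∀ x < 20, s'.reg x = s.reg x) ∧
      IsNext bit k (s.reg 22) (s.reg 20) (s.reg 21) (s'.reg 23) ∧ s'.reg 23 ≤ n + 2 ∧
      t ≤ κ₀ + κ₁ * (min (s'.reg 23) (s.reg 21) - s.reg 20)

/-- The data with which the detection algorithm works: search programs `q₁`, `q₂` for the steps
`1` and `2` on a binary string of length `n`, and words that are long enough. -/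
structure Oracles (w n z : ℕ) (A : ℕ → ℕ → ℕ) (bit : ℕ → ℕ) (κ₀ κ₁ : ℕ) (q₁ q₂ : Prog) :
    Prop where
  all : Searches w n z A bit κ₀ κ₁ 1 q₁
  alternate : Searches w n z A bit κ₀ κ₁ 2 q₂
  bit_le : ∀ x, bit x ≤ 1
  room : 8 * (n + 4) ≤ 2 ^ w

theorem Oracles.pos {w n z : ℕ} {A : ℕ → ℕ → ℕ} {bit : ℕ → ℕ} {κ₀ κ₁ : ℕ} {q₁ q₂ : Prog}
    (O : Oracles w n z A bit κ₀ κ₁ q₁ q₂) : w ≠ 0 := by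
  have := O.room
  rintro rfl
  omega

/-- Search for the character `c` from `a` to `b`. -/
def search (q : Prog) (c a b : Expr) : Prog :=
  .seq (.assign 20 a) (.seq (.assign 21 b) (.seq (.assign 22 c) q))

theorem run_search {w n z k κ₀ κ₁ : ℕ} {A : ℕ → ℕ → ℕ} {bit : ℕ → ℕ} {q : Prog}
    (hq : Searches w n z A bit κ₀ κ₁ k q) {s : State} {Q : ℕ → State → Prop}
    {ec ea eb : Expr} (a b c : ℕ) (hA : s.arr = A) (hz : s.reg 0 = z)
    (ha : ea.Fits w s ∧ ea.eval s = a)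
    (hb : eb.Fits w (s.setReg 20 a) ∧ eb.eval (s.setReg 20 a) = b)
    (hc : ec.Fits w ((s.setReg 20 a).setReg 21 b) ∧ ec.eval ((s.setReg 20 a).setReg 21 b) = c)
    (h1 : 1 ≤ a) (hab : a ≤ b) (hbn : b ≤ n) (hc1 : c ≤ 1)
    (h : ∀ t s', s'.arr = A → (∀ x < 20, s'.reg x = s.reg x) →
      IsNext bit k c a b (s'.reg 23) → s'.reg 23 ≤ n + 2 →
      t ≤ κ₀ + κ₁ * (min (s'.reg 23) b - a) →
      Q (ea.cost + 1 + (eb.cost + 1 + (ec.cost + 1 + t))) s') :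
    Run w (search q ec ea eb) s Q := by
  refine .seq (.assign ha.1 (.seq (.assign ?_ (.seq (.assign ?_ ?_)))))
  · rw [ha.2]; exact hb.1
  · rw [ha.2, hb.2]; exact hc.1
  rw [ha.2, hb.2, hc.2]
  refine (hq _ (by simpa using hA) (by simpa using hz) (by simpa using h1) (by simpa using hab)
    (by simpa using hbn) (by simpa using hc1)).mono ?_
  rintro t s' ⟨h1, h2, h3, h4, h5⟩
  simp only [setReg_reg] at h2 h3 h5
  refine h t s' h1 (fun x hx => ?_) (by simpa using h3) h4 (by simpa using h5)
  rw [h2 x hx, if_neg (by omega), if_neg (by omega), if_neg (by omega)]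

/-- One round of the search for a cadence whose left class, from register `10` to `11`, is
constantly `c` (register `14`); the right class goes from register `12` to `13`. The next right
index with character `c`, starting from register `15`, is compared with the next occurrence of `c`
behind the first midpoint of this index. If that occurrence lies behind its last midpoint, then the
search goes on at the right index whose last midpoint it is. Register `16` tells whether to go on,
register `9` is the answer. -/
def constRound (q₁ q₂ : Prog) : Prog :=
  .seq (search q₂ (.var 14) (.var 15) (.var 13)) <|
  .seq (.assign 17 (.var 23)) <|
  .ite (.lt (.var 13) (.var 17)) (.assign 16 (.const 0)) <|
  .seq (search q₁ (.var 14) (.half (.add (.var 10) (.var 17)))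
    (.half (.add (.var 11) (.var 13)))) <|
  .ite (.lt (.half (.add (.var 11) (.var 13))) (.var 23)) (.assign 16 (.const 0)) <|
  .ite (.lt (.half (.add (.var 11) (.var 17))) (.var 23))
    (.assign 15 (.sub (.add (.var 23) (.var 23)) (.var 11)))
    (.seq (.assign 9 (.const 1)) (.assign 16 (.const 0)))

/-- No right index below `cur` belongs to a cadence, if the left class is constantly `c`. -/
def NoneBefore (bit : ℕ → ℕ) (c i₀ i₁ j₀ cur : ℕ) : Prop :=
  ∀ j, j₀ ≤ j → j < cur → j % 2 = j₀ % 2 → bit j = c →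
    ∀ m, (i₀ + j) / 2 ≤ m → m ≤ (i₁ + j) / 2 → bit m ≠ c

theorem not_hasClassCadence_of_noneBefore {bit : ℕ → ℕ} {c i₀ i₁ j₀ j₁ cur : ℕ}
    (hconst : ∀ x, i₀ ≤ x → x ≤ i₁ → x % 2 = i₀ % 2 → bit x = c)
    (h : NoneBefore bit c i₀ i₁ j₀ cur) (hcur : j₁ < cur) :
    ¬ HasClassCadence bit i₀ i₁ j₀ j₁ := by
  rintro ⟨i, j, h1, h2, h3, h4, h5, h6, h7, h8⟩
  have := hconst i h1 h2 h5
  exact h j h3 (by omega) h6 (by omega) ((i + j) / 2) (by omega) (by omega) (by omega)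

section Const

variable {w n z κ₀ κ₁ : ℕ} {A : ℕ → ℕ → ℕ} {bit : ℕ → ℕ} {q₁ q₂ : Prog}
  {i₀ i₁ j₀ j₁ c : ℕ}

/-- The registers of `constRound`. -/
structure ConstRegs (s : State) (A : ℕ → ℕ → ℕ) (z i₀ i₁ j₀ j₁ c cur : ℕ) : Prop where
  arr : s.arr = A
  reg0 : s.reg 0 = z
  reg10 : s.reg 10 = i₀
  reg11 : s.reg 11 = i₁
  reg12 : s.reg 12 = j₀
  reg13 : s.reg 13 = j₁
  reg14 : s.reg 14 = c
  reg15 : s.reg 15 = cur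

/-- Two nonempty classes of indices of the same parity, given by their first and last members. -/
structure ClassPair (n i₀ i₁ j₀ j₁ : ℕ) : Prop where
  one_le : 1 ≤ i₀
  le_i : i₀ ≤ i₁
  i_le : i₁ ≤ n
  le_j : j₀ ≤ j₁
  j_le : j₁ ≤ n
  one_le' : 1 ≤ j₀
  par_i : i₁ % 2 = i₀ % 2
  par_j₀ : j₀ % 2 = i₀ % 2
  par_j₁ : j₁ % 2 = i₀ % 2

theorem ClassPair.swap (C : ClassPair n i₀ i₁ j₀ j₁) : ClassPair n j₀ j₁ i₀ i₁ := by
  obtain ⟨h1, h2, h3, h4, h5, h6, h7, h8, h9⟩ := C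
  exact ⟨h6, h4, h5, h2, h3, h1, by omega, by omega, by omega⟩

/-- A pair of classes, the first of them constantly `c`. -/
structure ConstClass (bit : ℕ → ℕ) (n i₀ i₁ j₀ j₁ c : ℕ) : Prop extends
    ClassPair n i₀ i₁ j₀ j₁ where
  c_le : c ≤ 1
  const : ∀ x, i₀ ≤ x → x ≤ i₁ → x % 2 = i₀ % 2 → bit x = c

set_option maxHeartbeats 1000000 in
theorem run_constRound (O : Oracles w n z A bit κ₀ κ₁ q₁ q₂)
    (C : ConstClass bit n i₀ i₁ j₀ j₁ c) {s : State} {cur : ℕ}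
    (hs : ConstRegs s A z i₀ i₁ j₀ j₁ c cur) (h16 : s.reg 16 = 1)
    (hcur₀ : j₀ ≤ cur) (hcur₁ : cur ≤ j₁) (hcurp : cur % 2 = i₀ % 2)
    (hnone : NoneBefore bit c i₀ i₁ j₀ cur) :
    Run w (constRound q₁ q₂) s fun t s' => (∀ x < 9, s'.reg x = s.reg x) ∧ s'.arr = A ∧
      ((s'.reg 16 = 0 ∧ (s'.reg 9 = 1 ∧ HasClassCadence bit i₀ i₁ j₀ j₁ ∨
          s'.reg 9 = s.reg 9 ∧ ¬ HasClassCadence bit i₀ i₁ j₀ j₁) ∧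
        t ≤ 2 * κ₀ + 60 + κ₁ * (2 * (j₁ - cur) + (i₁ - i₀))) ∨
      ∃ cur', s'.reg 16 = 1 ∧ s'.reg 9 = s.reg 9 ∧ ConstRegs s' A z i₀ i₁ j₀ j₁ c cur' ∧
        cur < cur' ∧ cur' ≤ j₁ ∧ cur' % 2 = i₀ % 2 ∧ NoneBefore bit c i₀ i₁ j₀ cur' ∧
        bit ((i₁ + cur') / 2) = c ∧
        (bit ((i₁ + cur) / 2) = c → cur + (i₁ - i₀) + 2 ≤ cur') ∧
        t ≤ 2 * κ₀ + 60 + κ₁ * (cur' - cur + (i₁ - i₀))) := by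
  obtain ⟨hA, h0, h10, h11, h12, h13, h14, h15⟩ := hs
  obtain ⟨⟨hi1, hi, hin, hj, hjn, hj1, hpi, hpj0, hpj1⟩, hc, hconst⟩ := C
  have hW := O.room
  have hw := O.pos
  refine .seq (run_search O.alternate cur j₁ c hA h0 ?_ ?_ ?_ (by omega) hcur₁ hjn hc ?_)
  · simp [Expr.Fits, Expr.eval, h15]; omega
  · simp [Expr.Fits, Expr.eval, h13]; omega
  · simp [Expr.Fits, Expr.eval, h14]; omega
  intro t₁ s₁ hA₁ hf₁ hr₁ hn₁ ht₁
  generalize hj' : s₁.reg 23 = j at *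
  refine .seq (.assign ?_ (.ite ?_ ?_ ?_))
  · simp [Expr.Fits, hj']; omega
  · simp [Expr.Fits, Expr.eval, hj', hf₁, h13]; omega
  · intro hlt
    simp [Expr.eval, hj', hf₁, h13] at hlt
    refine .assign ?_ ⟨?_, by simpa using hA₁, Or.inl ⟨by simp [Expr.eval], Or.inr ⟨?_, ?_⟩, ?_⟩⟩
    · simp [Expr.Fits]
    · intro x hx
      simp [hf₁ x (by omega), show x ≠ 16 by omega, show x ≠ 17 by omega]
    · simp [hf₁]
    · refine not_hasClassCadence_of_noneBefore (cur := j₁ + 1) hconst ?_ (by omega)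
      intro j' h1 h2 h3 h4
      by_cases h5 : j' < cur
      · exact hnone j' h1 h5 h3 h4
      · exact absurd h4 (hr₁.none j' (by omega) (by omega) (by omega) (by omega))
    · have := Nat.mul_le_mul_left κ₁
        (show min j j₁ - cur ≤ 2 * (j₁ - cur) + (i₁ - i₀) by omega)
      simp [Expr.cost]
      omega
  intro hlt
  simp [Expr.eval, hj', hf₁, h13] at hlt
  obtain ⟨hjc, hjp⟩ := hr₁.hit hlt
  have hcj := hr₁.le
  have hnone' : NoneBefore bit c i₀ i₁ j₀ j := by
    intro j' h1 h2 h3 h4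
    by_cases h5 : j' < cur
    · exact hnone j' h1 h5 h3 h4
    · exact absurd h4 (hr₁.none j' (by omega) (by omega) (by omega) (by omega))
  refine .seq (run_search O.all ((i₀ + j) / 2) ((i₁ + j₁) / 2) c (by simpa using hA₁)
    (by simp [hf₁, h0]) ?_ ?_ ?_ (by omega) (by omega) (by omega) hc ?_)
  · simp [Expr.Fits, Expr.eval, h10, hf₁, hj']; omega
  · simp [Expr.Fits, Expr.eval, h11, h13, hf₁]; omega
  · simp [Expr.Fits, Expr.eval, h14, hf₁]; omega
  intro t₂ s₂ hA₂ hf₂ hr₂ hn₂ ht₂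
  generalize hm' : s₂.reg 23 = m at *
  have hs₂ : ∀ x < 20, s₂.reg x = if x = 17 then j else s.reg x := by
    intro x hx
    rw [hf₂ x hx, setReg_reg, Expr.eval, hj', hf₁ x hx]
  have hfr : ∀ x < 9, s₂.reg x = s.reg x := fun x hx => by
    rw [hs₂ x (by omega), if_neg (by omega)]
  clear hf₁ hf₂
  refine .ite ?_ ?_ ?_
  · simp [Expr.Fits, Expr.eval, hs₂, h11, h13, hm']; omega
  · intro hlt₂
    simp [Expr.eval, hs₂, h11, h13, hm'] at hlt₂
    refine .assign (by simp [Expr.Fits]) ⟨?_, hA₂, Or.inl ⟨by simp [Expr.eval],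
      Or.inr ⟨by simp [hs₂], ?_⟩, ?_⟩⟩
    · intro x hx
      simp [hfr x hx, show x ≠ 16 by omega]
    · refine not_hasClassCadence_of_noneBefore (cur := j₁ + 1) hconst ?_ (by omega)
      intro j' h1 h2 h3 h4 m' h5 h6
      by_cases h7 : j' < j
      · exact hnone' j' h1 h7 h3 h4 m' h5 h6
      · exact hr₂.none m' (by omega) (by omega) (by omega) (by omega)
    · have := Nat.mul_le_mul_left κ₁
        (show (min j j₁ - cur) + (min m ((i₁ + j₁) / 2) - (i₀ + j) / 2) ≤
          2 * (j₁ - cur) + (i₁ - i₀) by omega)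
      rw [mul_add] at this
      simp [Expr.cost]
      omega
  intro hlt₂
  simp [Expr.eval, hs₂, h11, h13, hm'] at hlt₂
  obtain ⟨hmc, -⟩ := hr₂.hit hlt₂
  have hjm := hr₂.le
  refine .ite ?_ ?_ ?_
  · simp [Expr.Fits, Expr.eval, hs₂, h11, hm']; omega
  · intro hlt₃
    simp [Expr.eval, hs₂, h11, hm'] at hlt₃
    have hcand : bit ((i₁ + (m + m - i₁)) / 2) = c := by
      rw [show (i₁ + (m + m - i₁)) / 2 = m by omega, hmc]
    refine .assign ?_ ⟨?_, hA₂, Or.inr ⟨m + m - i₁, ?_⟩⟩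
    · simp [Expr.Fits, Expr.eval, hs₂, h11, hm']; omega
    · intro x hx
      simp [hfr x hx, show x ≠ 15 by omega]
    refine ⟨by simp [hs₂, h16], by simp [hs₂], ⟨by simp [hA₂], by simp [hs₂, h0],
      by simp [hs₂, h10], by simp [hs₂, h11], by simp [hs₂, h12], by simp [hs₂, h13],
      by simp [hs₂, h14], by simp [Expr.eval, hs₂, h11, hm']⟩, by omega, by omega, by omega,
      ?_, hcand, ?_, ?_⟩
    · intro j' h1 h2 h3 h4 m' h5 h6
      by_cases h7 : j' < j
      · exact hnone' j' h1 h7 h3 h4 m' h5 h6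
      · exact hr₂.none m' (by omega) (by omega) (by omega) (by omega)
    · -- the midpoint that ended the previous round lies in the window of every right index
      -- below `cur + (i₁ - i₀) + 2`
      intro hcur
      by_contra hcon
      exact hr₂.none ((i₁ + cur) / 2) (by omega) (by omega) (by omega) (by omega) hcur
    · have := Nat.mul_le_mul_left κ₁
        (show (min j j₁ - cur) + (min m ((i₁ + j₁) / 2) - (i₀ + j) / 2) ≤
          m + m - i₁ - cur + (i₁ - i₀) by omega)
      rw [mul_add] at this
      simp [Expr.cost]
      omega
  · intro hlt₃
    simp [Expr.eval, hs₂, h11, hm'] at hlt₃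
    refine .seq (.assign (by simp [Expr.Fits]; omega) (.assign (by simp [Expr.Fits])
      ⟨?_, hA₂, Or.inl ⟨by simp [Expr.eval], Or.inl ⟨by simp [Expr.eval], ?_⟩, ?_⟩⟩))
    · intro x hx
      simp [hfr x hx, show x ≠ 9 by omega, show x ≠ 16 by omega]
    · exact hasClassCadence_of_const hpi hpj0 hconst (by omega) hlt (by omega) hjc hjm hlt₃ hmc rfl
    · have := Nat.mul_le_mul_left κ₁
        (show (min j j₁ - cur) + (min m ((i₁ + j₁) / 2) - (i₀ + j) / 2) ≤
          2 * (j₁ - cur) + (i₁ - i₀) by omega)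
      rw [mul_add] at this
      simp [Expr.cost]
      omega

end Const
end WordRAM

/-! ### One constant class -/

namespace WordRAM

section Const

variable {w n z κ₀ κ₁ : ℕ} {A : ℕ → ℕ → ℕ} {bit : ℕ → ℕ} {q₁ q₂ : Prog}
  {i₀ i₁ j₀ j₁ c : ℕ}

/-- Detection of a cadence whose left class is constant. -/
def constSearch (q₁ q₂ : Prog) : Prog :=
  .seq (.assign 15 (.var 12)) <| .seq (.assign 16 (.const 1)) <|
  .loop (.var 16) (constRound q₁ q₂)

/-- The rounds after the first one advance by at least the length of the left class: at the start
of such a round the character `c` stands at the last midpoint of the current right index, so this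
midpoint completes a cadence unless the next right index is out of its reach. Hence the number `k`
of rounds is at most the quotient of the two lengths, up to an additive constant. -/
theorem run_constLoop (O : Oracles w n z A bit κ₀ κ₁ q₁ q₂)
    (C : ConstClass bit n i₀ i₁ j₀ j₁ c) {s : State} {cur : ℕ}
    (hs : ConstRegs s A z i₀ i₁ j₀ j₁ c cur) (h16 : s.reg 16 = 1)
    (hcur₀ : j₀ ≤ cur) (hcur₁ : cur ≤ j₁) (hcurp : cur % 2 = i₀ % 2)
    (hnone : NoneBefore bit c i₀ i₁ j₀ cur) :
    Run w (.loop (.var 16) (constRound q₁ q₂)) s fun t s' =>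
      (∀ x < 9, s'.reg x = s.reg x) ∧ s'.arr = A ∧
      (s'.reg 9 = 1 ∧ HasClassCadence bit i₀ i₁ j₀ j₁ ∨
        s'.reg 9 = s.reg 9 ∧ ¬ HasClassCadence bit i₀ i₁ j₀ j₁) ∧
      ∃ k, k * (i₁ - i₀ + 2) ≤ j₁ - cur +
          (if bit ((i₁ + cur) / 2) = c then 2 else 3) * (i₁ - i₀ + 2) ∧
        t ≤ k * (2 * κ₀ + 62) + 2 + κ₁ * (2 * (j₁ - cur) + k * (i₁ - i₀ + 2)) := by
  have hw := O.pos
  obtain ⟨d, hd⟩ : ∃ d, d = j₁ - cur := ⟨_, rfl⟩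
  induction d using Nat.strong_induction_on generalizing cur s with
  | _ d ih =>
    refine .loop (by simp [Expr.Fits, h16]; omega) (fun _ => ?_)
      (fun h => by simp [Expr.eval, h16] at h)
    refine (run_constRound O C hs h16 hcur₀ hcur₁ hcurp hnone).mono ?_
    rintro t s' ⟨hf, hA, ⟨h16', h9, ht⟩ |
      ⟨cur', h16', h9, hs', hlt, hle, hp, hnone', hcand, hjump, ht⟩⟩
    · refine .loop (by simp [Expr.Fits, h16']) (fun h => by simp [Expr.eval, h16'] at h)
        (fun _ => ⟨hf, hA, h9, 1, ?_, ?_⟩)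
      · split_ifs <;> omega
      · have := Nat.mul_le_mul_left κ₁ (show 2 * (j₁ - cur) + (i₁ - i₀) ≤
          2 * (j₁ - cur) + 1 * (i₁ - i₀ + 2) by omega)
        simp [Expr.cost] at *
        omega
    · refine (ih (j₁ - cur') (by omega) hs' h16' (by omega) hle hp hnone' rfl).mono ?_
      rintro t' s'' ⟨hf', hA', h9', k, hk, ht'⟩
      rw [if_pos hcand] at hk
      refine ⟨fun x hx => by rw [hf' x hx, hf x hx], hA', by rwa [h9] at h9', k + 1, ?_, ?_⟩
      · rw [add_mul]
        split_ifs with hc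
        · have := hjump hc
          omega
        · omega
      · have := Nat.mul_le_mul_left κ₁ (show cur' - cur + (i₁ - i₀) +
          (2 * (j₁ - cur') + k * (i₁ - i₀ + 2)) ≤
          2 * (j₁ - cur) + (k * (i₁ - i₀ + 2) + 1 * (i₁ - i₀ + 2)) by omega)
        rw [mul_add κ₁ (cur' - cur + (i₁ - i₀))] at this
        rw [add_mul k, add_mul k]
        simp only [Expr.cost] at *
        omega

theorem run_constSearch (O : Oracles w n z A bit κ₀ κ₁ q₁ q₂)
    (C : ConstClass bit n i₀ i₁ j₀ j₁ c) {s : State}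
    (hA : s.arr = A) (h0 : s.reg 0 = z) (h10 : s.reg 10 = i₀) (h11 : s.reg 11 = i₁)
    (h12 : s.reg 12 = j₀) (h13 : s.reg 13 = j₁) (h14 : s.reg 14 = c) :
    Run w (constSearch q₁ q₂) s fun t s' =>
      (∀ x < 9, s'.reg x = s.reg x) ∧ s'.arr = A ∧
      (s'.reg 9 = 1 ∧ HasClassCadence bit i₀ i₁ j₀ j₁ ∨
        s'.reg 9 = s.reg 9 ∧ ¬ HasClassCadence bit i₀ i₁ j₀ j₁) ∧
      ∃ k, k * (i₁ - i₀ + 2) ≤ j₁ - j₀ + 3 * (i₁ - i₀ + 2) ∧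
        t ≤ k * (2 * κ₀ + 62) + 6 + κ₁ * (3 * (j₁ - j₀) + 3 * (i₁ - i₀ + 2)) := by
  have hw := O.pos
  have hW := O.room
  have := C.j_le
  have := C.le_j
  refine .seq (.assign (by simp [Expr.Fits, h12]; omega) (.seq (.assign
    (by simp [Expr.Fits]; omega) ?_)))
  refine (run_constLoop O C (cur := j₀) ⟨by simp [hA], by simp [h0], by simp [h10], by simp [h11],
    by simp [h12], by simp [h13], by simp [h14], by simp [Expr.eval, h12]⟩ (by simp [Expr.eval])
    le_rfl C.le_j C.par_j₀ (fun j h1 h2 => by omega)).mono ?_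
  rintro t s' ⟨hf, hA', h9, k, hk, ht⟩
  have hk' : k * (i₁ - i₀ + 2) ≤ j₁ - j₀ + 3 * (i₁ - i₀ + 2) := by
    split_ifs at hk <;> omega
  refine ⟨fun x hx => ?_, hA', by simpa using h9, k, hk', ?_⟩
  · simp [hf x hx, show x ≠ 15 by omega, show x ≠ 16 by omega]
  · have := Nat.mul_le_mul_left κ₁ (show 2 * (j₁ - j₀) + k * (i₁ - i₀ + 2) ≤
      3 * (j₁ - j₀) + 3 * (i₁ - i₀ + 2) by omega)
    simp only [Expr.cost] at *
    omega

end Const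

/-- Both classes change their character once, at `a` and `b` respectively, in the same
direction. Then two equal characters lie on the same side of the changes, and so does their
midpoint. -/
theorem not_hasClassCadence_of_one_change {bit : ℕ → ℕ} {i₀ i₁ j₀ j₁ a b c : ℕ}
    (hbit : ∀ x, bit x ≤ 1) (hc : c ≤ 1) (hpi : i₁ % 2 = i₀ % 2) (hpj : j₀ % 2 = i₀ % 2)
    (hpj₁ : j₁ % 2 = i₀ % 2)
    (ha : a % 2 = i₀ % 2) (hb : b % 2 = i₀ % 2) (hia : i₀ + 2 ≤ a) (hjb : j₀ + 2 ≤ b)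
    (h1 : ∀ x, i₀ ≤ x → x < a → x ≤ i₁ → x % 2 = i₀ % 2 → bit x ≠ 1 - c)
    (h2 : ∀ x, a ≤ x → x ≤ i₁ → x % 2 = a % 2 → bit x ≠ c)
    (h3 : ∀ x, j₀ ≤ x → x < b → x ≤ j₁ → x % 2 = j₀ % 2 → bit x ≠ 1 - c)
    (h4 : ∀ x, b ≤ x → x ≤ j₁ → x % 2 = b % 2 → bit x ≠ c)
    (h5 : ∀ x, (i₀ + j₀) / 2 ≤ x → x ≤ (a + b) / 2 - 2 → bit x ≠ c)
    (h6 : ∀ x, (a + b) / 2 ≤ x → x ≤ (i₁ + j₁) / 2 → bit x ≠ 1 - c) :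
    ¬ HasClassCadence bit i₀ i₁ j₀ j₁ := by
  rintro ⟨i, j, g1, g2, g3, g4, g5, g6, g7, g8⟩
  have := hbit i
  by_cases hi : i < a <;> by_cases hj : j < b
  · have := h1 i g1 hi g2 g5
    exact h5 ((i + j) / 2) (by omega) (by omega) (by omega)
  · have := h1 i g1 hi g2 g5
    exact h4 j (by omega) g4 (by omega) (by omega)
  · have := h3 j g3 hj g4 g6
    exact h2 i (by omega) g2 (by omega) (by omega)
  · have := h2 i (by omega) g2 (by omega)
    exact h6 ((i + j) / 2) (by omega) (by omega) (by omega)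

/-- If `c` is constant on `[a₀, a₁]` in the left class and on `[b₀, b₁]` in the right one, then
any occurrence of `c` at a midpoint completes a cadence. -/
theorem hasClassCadence_of_const_const {bit : ℕ → ℕ} {i₀ i₁ j₀ j₁ a₀ a₁ b₀ b₁ c m : ℕ}
    (ha₀ : i₀ ≤ a₀) (ha₁ : a₁ ≤ i₁) (hb₀ : j₀ ≤ b₀) (hb₁ : b₁ ≤ j₁) (ha : a₀ ≤ a₁) (hb : b₀ ≤ b₁)
    (hp : j₀ % 2 = i₀ % 2) (hpa₀ : a₀ % 2 = i₀ % 2) (hpa₁ : a₁ % 2 = i₀ % 2)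
    (hpb₀ : b₀ % 2 = i₀ % 2) (hpb₁ : b₁ % 2 = i₀ % 2)
    (h1 : ∀ x, a₀ ≤ x → x ≤ a₁ → x % 2 = i₀ % 2 → bit x = c)
    (h2 : ∀ x, b₀ ≤ x → x ≤ b₁ → x % 2 = i₀ % 2 → bit x = c)
    (hm₀ : (a₀ + b₀) / 2 ≤ m) (hm₁ : m ≤ (a₁ + b₁) / 2) (hm : bit m = c) :
    HasClassCadence bit i₀ i₁ j₀ j₁ := by
  obtain ⟨i, j, h3, h4, h5, h6, h7, h8⟩ : ∃ i j, a₀ ≤ i ∧ i ≤ a₁ ∧ b₀ ≤ j ∧ j ≤ b₁ ∧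
      i % 2 = i₀ % 2 ∧ i + j = 2 * m := by
    rcases le_or_gt (a₀ + b₁) (2 * m) with h | h
    · exact ⟨2 * m - b₁, b₁, by omega, by omega, by omega, by omega, by omega, by omega⟩
    · exact ⟨a₀, 2 * m - a₀, by omega, by omega, by omega, by omega, by omega, by omega⟩
  have g1 := h1 i h3 h4 h7
  have g2 := h2 j h5 h6 (by omega)
  exact ⟨i, j, by omega, by omega, by omega, by omega, h7, by omega, by omega,
    by rw [show (i + j) / 2 = m by omega, hm, g1]⟩

end WordRAM

/-! ### Two classes that are not constant -/

namespace WordRAM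

section Detect

variable {w n z κ₀ κ₁ : ℕ} {A : ℕ → ℕ → ℕ} {bit : ℕ → ℕ} {q₁ q₂ : Prog}
  {i₀ i₁ j₀ j₁ : ℕ}

/-- The outcome of a test for a cadence in a pair of classes: the answer is recorded in
register `9`, and the input is kept. -/
def Tested (A : ℕ → ℕ → ℕ) (bit : ℕ → ℕ) (i₀ i₁ j₀ j₁ : ℕ) (s s' : State) : Prop :=
  (∀ x < 9, s'.reg x = s.reg x) ∧ s'.arr = A ∧
    (s'.reg 9 = 1 ∧ HasClassCadence bit i₀ i₁ j₀ j₁ ∨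
      s'.reg 9 = s.reg 9 ∧ ¬ HasClassCadence bit i₀ i₁ j₀ j₁)

/-- Detection if neither class is constant. Their first characters are in the registers `14` and
`16`, and their first changes of character in the registers `15` and `17`. There is a cadence
unless the first characters agree and each class changes its character only once; then it remains
to look at the midpoints of the two parts. -/
def changeSearch (q₁ q₂ : Prog) : Prog :=
  .ite (.add (.sub (.var 14) (.var 16)) (.sub (.var 16) (.var 14))) (.assign 9 (.const 1)) <|
  .seq (search q₂ (.var 14) (.var 15) (.var 11)) <|
  .ite (.lt (.var 23) (.add (.var 11) (.const 1))) (.assign 9 (.const 1)) <|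
  .seq (search q₂ (.var 14) (.var 17) (.var 13)) <|
  .ite (.lt (.var 23) (.add (.var 13) (.const 1))) (.assign 9 (.const 1)) <|
  .seq (search q₁ (.var 14) (.half (.add (.var 10) (.var 12)))
    (.sub (.half (.add (.var 15) (.var 17))) (.const 2))) <|
  .ite (.lt (.var 23) (.sub (.half (.add (.var 15) (.var 17))) (.const 1)))
    (.assign 9 (.const 1)) <|
  .seq (search q₁ (.sub (.const 1) (.var 14)) (.half (.add (.var 15) (.var 17)))
    (.half (.add (.var 11) (.var 13)))) <|
  .ite (.lt (.var 23) (.add (.half (.add (.var 11) (.var 13))) (.const 1)))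
    (.assign 9 (.const 1)) .skip

/-- A run that writes the answer `yes`. -/
theorem Tested.yes {s s₁ : State} (hf : ∀ x < 20, s₁.reg x = s.reg x) (hA : s₁.arr = A)
    (h : HasClassCadence bit i₀ i₁ j₀ j₁) :
    Tested A bit i₀ i₁ j₀ j₁ s (s₁.setReg 9 1) :=
  ⟨fun x hx => by simp [hf x (by omega), show x ≠ 9 by omega], hA, .inl ⟨by simp, h⟩⟩

set_option maxHeartbeats 1000000 in
theorem run_changeSearch (O : Oracles w n z A bit κ₀ κ₁ q₁ q₂) (C : ClassPair n i₀ i₁ j₀ j₁)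
    {s : State} {c d a b : ℕ}
    (hA : s.arr = A) (h0 : s.reg 0 = z) (h10 : s.reg 10 = i₀) (h11 : s.reg 11 = i₁)
    (h12 : s.reg 12 = j₀) (h13 : s.reg 13 = j₁) (h14 : s.reg 14 = c) (h15 : s.reg 15 = a)
    (h16 : s.reg 16 = d) (h17 : s.reg 17 = b) (hc : bit i₀ = c) (hd : bit j₀ = d)
    (ha : IsNext bit 2 (1 - c) i₀ i₁ a) (hb : IsNext bit 2 (1 - d) j₀ j₁ b)
    (hai : a ≤ i₁) (hbj : b ≤ j₁) :
    Run w (changeSearch q₁ q₂) s fun t s' => Tested A bit i₀ i₁ j₀ j₁ s s' ∧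
      t ≤ 4 * κ₀ + 120 + κ₁ * (4 * (i₁ - i₀ + (j₁ - j₀) + 4)) := by
  have hW := O.room
  have hw := O.pos
  have hbit := O.bit_le
  have hc1 : c ≤ 1 := hc ▸ hbit _
  have hd1 : d ≤ 1 := hd ▸ hbit _
  have hκ : κ₁ * (4 * (i₁ - i₀ + (j₁ - j₀) + 4)) = 4 * (κ₁ * (i₁ - i₀ + (j₁ - j₀) + 4)) := by ring
  obtain ⟨hi1, hi, hin, hj, hjn, hj1, hpi, hpj0, hpj1⟩ := C
  obtain ⟨ha1, ha2, ha3, ha4⟩ := ha.before hbit hc1 hai hc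
  obtain ⟨hb1, hb2, hb3, hb4⟩ := hb.before hbit hd1 hbj hd
  refine .ite (by simp [Expr.Fits, Expr.eval, h14, h16]; omega) (fun h => ?_) (fun h => ?_)
  · simp [Expr.eval, h14, h16] at h
    refine .assign (by simp [Expr.Fits]; omega) ⟨.yes (fun _ _ => rfl) hA ?_, by
      simp [Expr.cost]; omega⟩
    refine hasClassCadence_of_opposite_changes hbit (a := a - 2) (b := b - 2) ?_ ?_ ?_ ?_ ?_ ?_
      ?_ ?_ ?_ <;> grind
  simp [Expr.eval, h14, h16] at h
  obtain rfl : c = d := by omega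
  refine .seq (run_search O.alternate a i₁ c hA h0 (by simp [Expr.Fits, Expr.eval, h15]; omega)
    (by simp [Expr.Fits, Expr.eval, h11]; omega) (by simp [Expr.Fits, Expr.eval, h14]; omega)
    (by omega) hai hin hc1 fun t₁ s₁ hA₁ hf₁ hr₁ hn₁ ht₁ => ?_)
  replace ht₁ := ht₁.trans (Nat.add_le_add_left (Nat.mul_le_mul_left κ₁
    (show _ ≤ i₁ - i₀ + (j₁ - j₀) + 4 by omega)) _)
  generalize hr : s₁.reg 23 = r at *
  refine .ite (by simp [Expr.Fits, Expr.eval, hr, hf₁, h11]; omega) (fun h => ?_) (fun h => ?_)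
  · simp [Expr.eval, hr, hf₁, h11] at h
    refine .assign (by simp [Expr.Fits]; omega) ⟨.yes hf₁ hA₁ ?_, by simp [Expr.cost]; omega⟩
    obtain ⟨g1, g2⟩ := hr₁.hit (by omega)
    have g3 := hr₁.le
    have g4 : r ≠ a := by grind
    have g5 := hr₁.none (r - 2) (by omega) (by omega) (by omega) (by omega)
    have := hbit (r - 2)
    refine hasClassCadence_of_opposite_changes hbit (a := r - 2) (b := b - 2) ?_ ?_ ?_ ?_ ?_ ?_
      ?_ ?_ ?_ <;> grind
  simp [Expr.eval, hr, hf₁, h11] at h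
  have hx : ∀ x, a ≤ x → x ≤ i₁ → x % 2 = a % 2 → bit x ≠ c :=
    fun x g1 g2 g3 => hr₁.none x g1 (by omega) g2 g3
  clear hr hn₁ hr₁
  refine .seq (run_search O.alternate b j₁ c hA₁ (by simp [hf₁, h0])
    (by simp [Expr.Fits, Expr.eval, hf₁, h17]; omega)
    (by simp [Expr.Fits, Expr.eval, hf₁, h13]; omega)
    (by simp [Expr.Fits, Expr.eval, hf₁, h14]; omega)
    (by omega) hbj hjn hc1 fun t₂ s₂ hA₂ hf₂ hr₂ hn₂ ht₂ => ?_)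
  replace ht₂ := ht₂.trans (Nat.add_le_add_left (Nat.mul_le_mul_left κ₁
    (show _ ≤ i₁ - i₀ + (j₁ - j₀) + 4 by omega)) _)
  generalize hr : s₂.reg 23 = r at *
  replace hf₂ : ∀ x < 20, s₂.reg x = s.reg x := fun x hx => (hf₂ x hx).trans (hf₁ x hx)
  clear hf₁
  refine .ite (by simp [Expr.Fits, Expr.eval, hr, hf₂, h13]; omega) (fun h => ?_) (fun h => ?_)
  · simp [Expr.eval, hr, hf₂, h13] at h
    refine .assign (by simp [Expr.Fits]; omega) ⟨.yes hf₂ hA₂ ?_, by simp [Expr.cost]; omega⟩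
    obtain ⟨g1, g2⟩ := hr₂.hit (by omega)
    have g3 := hr₂.le
    have g4 : r ≠ b := by grind
    have g5 := hr₂.none (r - 2) (by omega) (by omega) (by omega) (by omega)
    have := hbit (r - 2)
    refine hasClassCadence_of_opposite_changes hbit (a := a - 2) (b := r - 2) ?_ ?_ ?_ ?_ ?_ ?_
      ?_ ?_ ?_ <;> grind
  simp [Expr.eval, hr, hf₂, h13] at h
  have hy : ∀ x, b ≤ x → x ≤ j₁ → x % 2 = b % 2 → bit x ≠ c :=
    fun x g1 g2 g3 => hr₂.none x g1 (by omega) g2 g3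
  clear hr hn₂ hr₂
  refine .seq (run_search O.all ((i₀ + j₀) / 2) ((a + b) / 2 - 2) c hA₂ (by simp [hf₂, h0])
    (by simp [Expr.Fits, Expr.eval, hf₂, h10, h12]; omega)
    (by simp [Expr.Fits, Expr.eval, hf₂, h15, h17]; omega)
    (by simp [Expr.Fits, Expr.eval, hf₂, h14]; omega)
    (by omega) (by omega) (by omega) hc1 fun t₃ s₃ hA₃ hf₃ hr₃ hn₃ ht₃ => ?_)
  replace ht₃ := ht₃.trans (Nat.add_le_add_left (Nat.mul_le_mul_left κ₁
    (show _ ≤ i₁ - i₀ + (j₁ - j₀) + 4 by omega)) _)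
  generalize hr : s₃.reg 23 = r at *
  replace hf₃ : ∀ x < 20, s₃.reg x = s.reg x := fun x hx => (hf₃ x hx).trans (hf₂ x hx)
  clear hf₂
  refine .ite (by simp [Expr.Fits, Expr.eval, hr, hf₃, h15, h17]; omega)
    (fun h => ?_) (fun h => ?_)
  · simp [Expr.eval, hr, hf₃, h15, h17] at h
    refine .assign (by simp [Expr.Fits]; omega) ⟨.yes hf₃ hA₃ ?_, by simp [Expr.cost]; omega⟩
    refine hasClassCadence_of_const_const (a₀ := i₀) (a₁ := a - 2) (b₀ := j₀) (b₁ := b - 2)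
      (c := c) (m := r) le_rfl (by omega) le_rfl (by omega) (by omega) (by omega) (by omega)
      rfl (by omega) (by omega) (by omega) (fun x g1 g2 g3 => ?_) (fun x g1 g2 g3 => ?_)
      hr₃.le (by omega) (hr₃.hit (by omega)).1
    · have := ha.none x g1 (by omega) (by omega) g3
      have := hbit x
      omega
    · have := hb.none x g1 (by omega) (by omega) (by omega)
      have := hbit x
      omega
  simp [Expr.eval, hr, hf₃, h15, h17] at h
  have hz₁ : ∀ x, (i₀ + j₀) / 2 ≤ x → x ≤ (a + b) / 2 - 2 → bit x ≠ c :=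
    fun x g1 g2 => hr₃.none x g1 (by omega) g2 (by omega)
  clear hr hn₃ hr₃
  refine .seq (run_search O.all ((a + b) / 2) ((i₁ + j₁) / 2) (1 - c) hA₃ (by simp [hf₃, h0])
    (by simp [Expr.Fits, Expr.eval, hf₃, h15, h17]; omega)
    (by simp [Expr.Fits, Expr.eval, hf₃, h11, h13]; omega)
    (by simp [Expr.Fits, Expr.eval, hf₃, h14]; omega)
    (by omega) (by omega) (by omega) (by omega) fun t₄ s₄ hA₄ hf₄ hr₄ hn₄ ht₄ => ?_)
  replace ht₄ := ht₄.trans (Nat.add_le_add_left (Nat.mul_le_mul_left κ₁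
    (show _ ≤ i₁ - i₀ + (j₁ - j₀) + 4 by omega)) _)
  generalize hr : s₄.reg 23 = r at *
  replace hf₄ : ∀ x < 20, s₄.reg x = s.reg x := fun x hx => (hf₄ x hx).trans (hf₃ x hx)
  clear hf₃
  refine .ite (by simp [Expr.Fits, Expr.eval, hr, hf₄, h11, h13]; omega)
    (fun h => ?_) (fun h => ?_)
  · simp [Expr.eval, hr, hf₄, h11, h13] at h
    refine .assign (by simp [Expr.Fits]; omega) ⟨.yes hf₄ hA₄ ?_, by simp [Expr.cost]; omega⟩
    refine hasClassCadence_of_const_const (a₀ := a) (a₁ := i₁) (b₀ := b) (b₁ := j₁)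
      (c := 1 - c) (m := r) (by omega) le_rfl (by omega) le_rfl (by omega) (by omega) (by omega)
      (by omega) (by omega) (by omega) (by omega) (fun x g1 g2 g3 => ?_) (fun x g1 g2 g3 => ?_)
      hr₄.le (by omega) (hr₄.hit (by omega)).1
    · have := hx x g1 g2 (by omega)
      have := hbit x
      omega
    · have := hy x g1 g2 (by omega)
      have := hbit x
      omega
  simp [Expr.eval, hr, hf₄, h11, h13] at h
  refine .skip ⟨⟨fun x hx => hf₄ x (by omega), hA₄, .inr ⟨hf₄ 9 (by omega), ?_⟩⟩, by
    simp [Expr.cost]; omega⟩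
  exact not_hasClassCadence_of_one_change (c := c) hbit hc1 hpi hpj0 hpj1 (by omega) (by omega)
    ha1 hb1 (fun x g1 g2 g3 g4 => ha.none x g1 g2 g3 g4) hx
    (fun x g1 g2 g3 g4 => hb.none x g1 g2 g3 g4) hy hz₁
    (fun x g1 g2 => hr₄.none x g1 (by omega) g2 (by omega))

end Detect

end WordRAM

namespace WordRAM

section Detect

variable {w n z κ₀ κ₁ : ℕ} {A : ℕ → ℕ → ℕ} {bit : ℕ → ℕ} {q₁ q₂ : Prog}
  {i₀ i₁ j₀ j₁ : ℕ}

/-- Exchange of the two classes. -/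
def exchange : Prog :=
  .seq (.assign 14 (.var 16)) <|
  .seq (.assign 18 (.var 10)) <| .seq (.assign 10 (.var 12)) <| .seq (.assign 12 (.var 18)) <|
  .seq (.assign 18 (.var 11)) <| .seq (.assign 11 (.var 13)) (.assign 13 (.var 18))

theorem run_exchange {s : State} (h : ∀ x ∈ [10, 11, 12, 13, 16], s.reg x < 2 ^ w) :
    Run w exchange s fun t s' => s'.arr = s.arr ∧ (∀ x < 10, s'.reg x = s.reg x) ∧
      s'.reg 10 = s.reg 12 ∧ s'.reg 11 = s.reg 13 ∧ s'.reg 12 = s.reg 10 ∧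
      s'.reg 13 = s.reg 11 ∧ s'.reg 14 = s.reg 16 ∧ t ≤ 20 := by
  refine .seq (.assign (h 16 (by simp)) <| .seq <| .assign ?_ <| .seq <| .assign ?_ <|
    .seq <| .assign ?_ <| .seq <| .assign ?_ <| .seq <| .assign ?_ <| .assign ?_ ?_)
  iterate 6
    · simp [Expr.Fits, Expr.eval, h]
  refine ⟨rfl, fun x hx => ?_, ?_⟩
  · simp [show x ≠ 10 by omega, show x ≠ 11 by omega, show x ≠ 12 by omega,
      show x ≠ 13 by omega, show x ≠ 14 by omega, show x ≠ 18 by omega]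
  · simp [Expr.eval, Expr.cost]

/-- Detection in a pair of classes, given by the registers `10, …, 13`: by `constSearch` if one of
the classes is constant, with the two classes exchanged if it is the right one, and by
`changeSearch` otherwise. -/
def classSearch (q₁ q₂ : Prog) : Prog :=
  .seq (search q₂ (.const 1) (.var 10) (.var 10)) <|
  .seq (.assign 14 (.lt (.var 23) (.add (.var 10) (.const 1)))) <|
  .seq (search q₂ (.sub (.const 1) (.var 14)) (.var 10) (.var 11)) <|
  .seq (.assign 15 (.var 23)) <|
  .ite (.lt (.var 11) (.var 15)) (constSearch q₁ q₂) <|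
  .seq (search q₂ (.const 1) (.var 12) (.var 12)) <|
  .seq (.assign 16 (.lt (.var 23) (.add (.var 12) (.const 1)))) <|
  .seq (search q₂ (.sub (.const 1) (.var 16)) (.var 12) (.var 13)) <|
  .seq (.assign 17 (.var 23)) <|
  .ite (.lt (.var 13) (.var 17))
    (.seq exchange (constSearch q₁ q₂))
    (changeSearch q₁ q₂)

set_option maxHeartbeats 1000000 in
theorem run_classSearch (O : Oracles w n z A bit κ₀ κ₁ q₁ q₂) (C : ClassPair n i₀ i₁ j₀ j₁)
    {s : State} (hA : s.arr = A) (h0 : s.reg 0 = z) (h10 : s.reg 10 = i₀) (h11 : s.reg 11 = i₁)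
    (h12 : s.reg 12 = j₀) (h13 : s.reg 13 = j₁) :
    Run w (classSearch q₁ q₂) s fun t s' => Tested A bit i₀ i₁ j₀ j₁ s s' ∧
      ∃ k, (k * (i₁ - i₀ + 2) ≤ j₁ - j₀ + 3 * (i₁ - i₀ + 2) ∨
          k * (j₁ - j₀ + 2) ≤ i₁ - i₀ + 3 * (j₁ - j₀ + 2)) ∧
        t ≤ k * (2 * κ₀ + 62) + 8 * κ₀ + 250 + κ₁ * (8 * (i₁ - i₀ + (j₁ - j₀) + 4)) := by
  have hW := O.room
  have hw := O.pos
  have hbit := O.bit_le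
  have hκ (k : ℕ) : κ₁ * (k * (i₁ - i₀ + (j₁ - j₀) + 4)) =
    k * (κ₁ * (i₁ - i₀ + (j₁ - j₀) + 4)) := by ring
  have hbi := hbit i₀
  have hbj := hbit j₀
  have C' := C
  obtain ⟨hi1, hi, hin, hj, hjn, hj1, hpi, hpj0, hpj1⟩ := C'
  refine .seq (run_search O.alternate i₀ i₀ 1 hA h0 (by simp [Expr.Fits, Expr.eval, h10]; omega)
    (by simp [Expr.Fits, Expr.eval, h10]; omega) (by simp [Expr.Fits, Expr.eval]; omega)
    (by omega) (by omega) (by omega) (by omega) fun t₁ s₁ hA₁ hf₁ hr₁ hn₁ ht₁ => ?_)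
  replace ht₁ := ht₁.trans (Nat.add_le_add_left (Nat.mul_le_mul_left κ₁
    (show _ ≤ i₁ - i₀ + (j₁ - j₀) + 4 by omega)) _)
  generalize hr : s₁.reg 23 = r at *
  have hc := hr₁.eval_char hbit
  refine .seq (.assign (by simp [Expr.Fits, Expr.eval, hr, hf₁, h10]; omega) ?_)
  simp only [Expr.eval, hr, hf₁, h10, hc, Nat.reduceLT]
  clear hr hr₁ hn₁ hc
  refine .seq (run_search O.alternate i₀ i₁ (1 - bit i₀) (by simpa using hA₁)
    (by simp [hf₁, h0]) (by simp [Expr.Fits, Expr.eval, hf₁, h10]; omega)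
    (by simp [Expr.Fits, Expr.eval, hf₁, h11]; omega) (by simp [Expr.Fits, Expr.eval]; omega)
    (by omega) (by omega) (by omega) (by omega) fun t₂ s₂ hA₂ hf₂ hr₂ hn₂ ht₂ => ?_)
  replace ht₂ := ht₂.trans (Nat.add_le_add_left (Nat.mul_le_mul_left κ₁
    (show _ ≤ i₁ - i₀ + (j₁ - j₀) + 4 by omega)) _)
  generalize hr : s₂.reg 23 = a at *
  refine .seq (.assign (by simp [Expr.Fits, hr]; omega) ?_)
  simp only [Expr.eval, hr]
  refine .ite (by simp [Expr.Fits, hf₁, hf₂, h11]; omega)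
    (fun h => ?_) (fun h => ?_)
  · simp [Expr.eval, hf₁, hf₂, h11] at h
    refine (run_constSearch O ⟨C, hbi, hr₂.const hbit hbi h⟩ (by simp [hA₂])
      (by simp [hf₁, hf₂, h0]) (by simp [hf₁, hf₂, h10]) (by simp [hf₁, hf₂, h11])
      (by simp [hf₁, hf₂, h12]) (by simp [hf₁, hf₂, h13]) (by simp [hf₂])).mono ?_
    rintro t s' ⟨g1, g2, g3, k, g4, g5⟩
    refine ⟨⟨fun x hx => ?_, g2, by simpa [hf₁, hf₂] using g3⟩, k, .inl g4, ?_⟩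
    · simp [g1 x hx, hf₁ x (by omega), hf₂ x (by omega), show x ≠ 14 by omega,
        show x ≠ 15 by omega]
    · have := Nat.mul_le_mul_left κ₁ (show 3 * (j₁ - j₀) + 3 * (i₁ - i₀ + 2) ≤
        3 * (i₁ - i₀ + (j₁ - j₀) + 4) by omega)
      rw [hκ] at this ⊢
      simp [Expr.cost]
      omega
  simp [Expr.eval, hf₁, hf₂, h11] at h
  replace hf₂ : ∀ x < 20, (s₂.setReg 15 a).reg x =
      if x = 15 then a else if x = 14 then bit i₀ else s.reg x := by
    intro x hx
    simp [hf₂ x hx, hf₁ x hx]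
  replace hA₂ : (s₂.setReg 15 a).arr = A := hA₂
  generalize s₂.setReg 15 a = s₃ at *
  clear hf₁ hr
  refine .seq (run_search O.alternate j₀ j₀ 1 hA₂ (by simp [hf₂, h0])
    (by simp [Expr.Fits, Expr.eval, hf₂, h12]; omega)
    (by simp [Expr.Fits, Expr.eval, hf₂, h12]; omega) (by simp [Expr.Fits, Expr.eval]; omega)
    (by omega) (by omega) (by omega) (by omega) fun t₃ s₃ hA₃ hf₃ hr₃ hn₃ ht₃ => ?_)
  replace ht₃ := ht₃.trans (Nat.add_le_add_left (Nat.mul_le_mul_left κ₁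
    (show _ ≤ i₁ - i₀ + (j₁ - j₀) + 4 by omega)) _)
  generalize hr : s₃.reg 23 = r at *
  have hc := hr₃.eval_char hbit
  refine .seq (.assign (by simp [Expr.Fits, Expr.eval, hr, hf₂, hf₃, h12]; omega) ?_)
  simp only [Expr.eval, hr, hf₂, hf₃, h12, hc, Nat.reduceLT, Nat.reduceEqDiff, if_false]
  clear hr hr₃ hn₃ hc
  refine .seq (run_search O.alternate j₀ j₁ (1 - bit j₀) (by simpa using hA₃)
    (by simp [hf₂, hf₃, h0]) (by simp [Expr.Fits, Expr.eval, hf₂, hf₃, h12]; omega)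
    (by simp [Expr.Fits, Expr.eval, hf₂, hf₃, h13]; omega)
    (by simp [Expr.Fits, Expr.eval]; omega)
    (by omega) (by omega) (by omega) (by omega) fun t₄ s₄ hA₄ hf₄ hr₄ hn₄ ht₄ => ?_)
  replace ht₄ := ht₄.trans (Nat.add_le_add_left (Nat.mul_le_mul_left κ₁
    (show _ ≤ i₁ - i₀ + (j₁ - j₀) + 4 by omega)) _)
  generalize hr : s₄.reg 23 = b at *
  refine .seq (.assign (by simp [Expr.Fits, hr]; omega) ?_)
  simp only [Expr.eval, hr]
  replace hf₄ : ∀ x < 20, (s₄.setReg 17 b).reg x = if x = 17 then b else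
      if x = 16 then bit j₀ else if x = 15 then a else if x = 14 then bit i₀ else s.reg x := by
    intro x hx
    simp [hf₄ x hx, hf₃ x hx, hf₂ x hx]
  replace hA₄ : (s₄.setReg 17 b).arr = A := hA₄
  generalize s₄.setReg 17 b = s₅ at *
  clear hf₂ hf₃ hr
  have hfr : ∀ x < 9, s₅.reg x = s.reg x := fun x hx => by
    rw [hf₄ x (by omega), if_neg (by omega), if_neg (by omega), if_neg (by omega),
      if_neg (by omega)]
  refine .ite (by simp [Expr.Fits, hf₄, h13]; omega) (fun g => ?_) (fun g => ?_)
  · simp [Expr.eval, hf₄, h13] at g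
    have hex : ∀ x ∈ [10, 11, 12, 13, 16], s₅.reg x < 2 ^ w := by
      simp [hf₄, h10, h11, h12, h13]
      omega
    refine .seq ((run_exchange hex).mono ?_)
    rintro t₅ s₆ ⟨g6, g7, g10, g11, g12, g13, g14, ht₅⟩
    simp only [hf₄, h10, h11, h12, h13, Nat.reduceLT, Nat.reduceEqDiff, if_false, if_true]
      at g10 g11 g12 g13 g14
    refine (run_constSearch O ⟨C.swap, hbj, hr₄.const hbit hbj g⟩ (g6.trans hA₄)
      (by simp [g7, hf₄, h0]) g10 g11 g12 g13 g14).mono ?_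
    rintro t s' ⟨g1, g2, g3, k, g4, g5⟩
    refine ⟨⟨fun x hx => ?_, g2, ?_⟩, k, .inr g4, ?_⟩
    · rw [g1 x hx, g7 x (by omega), hfr x hx]
    · rw [hasClassCadence_comm]
      simpa [g7, hf₄] using g3
    · have := Nat.mul_le_mul_left κ₁ (show 3 * (i₁ - i₀) + 3 * (j₁ - j₀ + 2) ≤
        3 * (i₁ - i₀ + (j₁ - j₀) + 4) by omega)
      rw [hκ] at this ⊢
      simp [Expr.cost]
      omega
  · simp [Expr.eval, hf₄, h13] at g
    refine (run_changeSearch O C hA₄ (by simp [hf₄, h0]) (by simp [hf₄, h10])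
      (by simp [hf₄, h11]) (by simp [hf₄, h12]) (by simp [hf₄, h13]) (by simp [hf₄])
      (by simp [hf₄]) (by simp [hf₄]) (by simp [hf₄]) rfl rfl hr₂ hr₄ h g).mono ?_
    rintro t s' ⟨⟨g1, g2, g3⟩, g4⟩
    refine ⟨⟨fun x hx => by rw [g1 x hx, hfr x hx], g2, by simpa [hf₄] using g3⟩, 0, by simp, ?_⟩
    rw [hκ] at g4 ⊢
    simp [Expr.cost]
    omega

end Detect

end WordRAM

/-! ### The detection algorithm -/

namespace WordRAM

section Detect

variable {w n z κ₀ κ₁ : ℕ} {A : ℕ → ℕ → ℕ} {bit : ℕ → ℕ} {q₁ q₂ : Prog}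
  {l₀ l₁ r₀ r₁ : ℕ}

/-- Detection for the indices of parity `p` in the intervals given by the registers
`1, …, 4`. -/
def paritySearch (q₁ q₂ : Prog) (p : ℕ) : Prog :=
  .seq (.assign 10 (.add (.var 1) (Expr.mod2 (.add (.var 1) (.const p))))) <|
  .seq (.assign 11 (.sub (.var 2) (Expr.mod2 (.add (.var 2) (.const p))))) <|
  .seq (.assign 12 (.add (.var 3) (Expr.mod2 (.add (.var 3) (.const p))))) <|
  .seq (.assign 13 (.sub (.var 4) (Expr.mod2 (.add (.var 4) (.const p))))) <|
  .ite (.lt (.var 11) (.var 10)) .skip <|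
  .ite (.lt (.var 13) (.var 12)) .skip (classSearch q₁ q₂)

/-- Some `i ∈ [l₀, l₁]` and `j ∈ [r₀, r₁]` of parity `p` carry the same character as their
midpoint. -/
def HasParityCadence (bit : ℕ → ℕ) (l₀ l₁ r₀ r₁ p : ℕ) : Prop :=
  ∃ i j, l₀ ≤ i ∧ i ≤ l₁ ∧ r₀ ≤ j ∧ j ≤ r₁ ∧ i % 2 = p ∧ j % 2 = p ∧
    bit i = bit j ∧ bit ((i + j) / 2) = bit i

set_option maxHeartbeats 1000000 in
/-- The number `N` bounds the quotients of the lengths of the two intervals. -/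
theorem run_paritySearch (O : Oracles w n z A bit κ₀ κ₁ q₁ q₂) {N p : ℕ} (hp : p ≤ 1)
    (hl₀ : 1 ≤ l₀) (hl : l₀ ≤ l₁) (hl₁ : l₁ ≤ n) (hr₀ : 1 ≤ r₀) (hr : r₀ ≤ r₁) (hr₁ : r₁ ≤ n)
    (hN₁ : ∀ k, k * (l₁ - l₀ + 1) ≤ 2 * (r₁ - r₀ + 1) + 3 * (l₁ - l₀ + 1) → k ≤ N)
    (hN₂ : ∀ k, k * (r₁ - r₀ + 1) ≤ 2 * (l₁ - l₀ + 1) + 3 * (r₁ - r₀ + 1) → k ≤ N)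
    {s : State} (hA : s.arr = A) (h0 : s.reg 0 = z) (h1 : s.reg 1 = l₀) (h2 : s.reg 2 = l₁)
    (h3 : s.reg 3 = r₀) (h4 : s.reg 4 = r₁) :
    Run w (paritySearch q₁ q₂ p) s fun t s' => (∀ x < 9, s'.reg x = s.reg x) ∧ s'.arr = A ∧
      (s'.reg 9 = 1 ∧ HasParityCadence bit l₀ l₁ r₀ r₁ p ∨
        s'.reg 9 = s.reg 9 ∧ ¬ HasParityCadence bit l₀ l₁ r₀ r₁ p) ∧
      t ≤ N * (2 * κ₀ + 62) + 8 * κ₀ + 400 + κ₁ * (8 * (l₁ - l₀ + (r₁ - r₀) + 4)) := by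
  have hW := O.room
  have hw := O.pos
  have hmod (e : Expr) (s : State) (h : e.Fits w s) (h' : e.eval s < 2 ^ w) :
    e.mod2.Fits w s := Expr.fits_mod2 h h'
  refine .seq (.assign ⟨?_, hmod _ _ ?_ ?_, ?_⟩ <| .seq <| .assign ⟨?_, hmod _ _ ?_ ?_⟩ <|
    .seq <| .assign ⟨?_, hmod _ _ ?_ ?_, ?_⟩ <| .seq <| .assign ⟨?_, hmod _ _ ?_ ?_⟩ ?_)
  iterate 14
    · simp [Expr.Fits, Expr.eval, Expr.eval_mod2, h1, h2, h3, h4]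
      omega
  generalize hs₁ : State.setReg _ 13 _ = s₁
  obtain ⟨i₀, hi₀⟩ : ∃ i₀, i₀ = l₀ + (l₀ + p) % 2 := ⟨_, rfl⟩
  obtain ⟨i₁, hi₁⟩ : ∃ i₁, i₁ = l₁ - (l₁ + p) % 2 := ⟨_, rfl⟩
  obtain ⟨j₀, hj₀⟩ : ∃ j₀, j₀ = r₀ + (r₀ + p) % 2 := ⟨_, rfl⟩
  obtain ⟨j₁, hj₁⟩ : ∃ j₁, j₁ = r₁ - (r₁ + p) % 2 := ⟨_, rfl⟩
  have g10 : s₁.reg 10 = i₀ := by simp [← hs₁, Expr.eval, Expr.eval_mod2, h1, hi₀]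
  have g11 : s₁.reg 11 = i₁ := by simp [← hs₁, Expr.eval, Expr.eval_mod2, h2, hi₁]
  have g12 : s₁.reg 12 = j₀ := by simp [← hs₁, Expr.eval, Expr.eval_mod2, h3, hj₀]
  have g13 : s₁.reg 13 = j₁ := by simp [← hs₁, Expr.eval, Expr.eval_mod2, h4, hj₁]
  have gA : s₁.arr = A := by simp [← hs₁, hA]
  have gf : ∀ x < 10, s₁.reg x = s.reg x := fun x hx => by
    simp [← hs₁, show x ≠ 10 by omega, show x ≠ 11 by omega, show x ≠ 12 by omega,
      show x ≠ 13 by omega]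
  clear hs₁
  refine .ite (by simp [Expr.Fits, g10, g11]; omega) (fun h => ?_) (fun h => ?_)
  · simp [Expr.eval, g10, g11] at h
    refine .skip ⟨fun x hx => gf x (by omega), gA, .inr ⟨gf 9 (by omega), ?_⟩, ?_⟩
    · rintro ⟨i, j, f1, f2, f3, f4, f5, f6, -⟩
      omega
    · simp [Expr.cost, Expr.cost_mod2]
      omega
  simp [Expr.eval, g10, g11] at h
  refine .ite (by simp [Expr.Fits, g12, g13]; omega) (fun h' => ?_) (fun h' => ?_)
  · simp [Expr.eval, g12, g13] at h'
    refine .skip ⟨fun x hx => gf x (by omega), gA, .inr ⟨gf 9 (by omega), ?_⟩, ?_⟩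
    · rintro ⟨i, j, f1, f2, f3, f4, f5, f6, -⟩
      omega
    · simp [Expr.cost, Expr.cost_mod2]
      omega
  simp [Expr.eval, g12, g13] at h'
  have hiff : HasParityCadence bit l₀ l₁ r₀ r₁ p ↔ HasClassCadence bit i₀ i₁ j₀ j₁ := by
    constructor
    · rintro ⟨i, j, f1, f2, f3, f4, f5, f6, f7⟩
      exact ⟨i, j, by omega, by omega, by omega, by omega, by omega, by omega, f7⟩
    · rintro ⟨i, j, f1, f2, f3, f4, f5, f6, f7⟩
      exact ⟨i, j, by omega, by omega, by omega, by omega, by omega, by omega, f7⟩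
  refine (run_classSearch O (i₀ := i₀) (i₁ := i₁) (j₀ := j₀) (j₁ := j₁)
    ⟨by omega, by omega, by omega, by omega, by omega, by omega, by omega, by omega, by omega⟩
    gA (by simp [gf, h0]) g10 g11 g12 g13).mono ?_
  rintro t s' ⟨⟨f1, f2, f3⟩, k, f4, f5⟩
  rw [hiff]
  refine ⟨fun x hx => by rw [f1 x hx, gf x (by omega)], f2, by rwa [gf 9 (by omega)] at f3, ?_⟩
  have hk : k ≤ N := by
    rcases Nat.lt_or_ge k 4 with hk | hk
    · refine (show k ≤ 3 by omega).trans (hN₁ 3 (by omega))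
    obtain ⟨k, rfl⟩ := Nat.exists_eq_add_of_le' (show 3 ≤ k by omega)
    rcases f4 with f4 | f4
    · refine hN₁ _ ?_
      have : k * (l₁ - l₀ + 1) ≤ 2 * (k * (i₁ - i₀ + 2)) := by
        rw [mul_left_comm]
        exact Nat.mul_le_mul_left _ (by omega)
      rw [add_mul] at f4 ⊢
      omega
    · refine hN₂ _ ?_
      have : k * (r₁ - r₀ + 1) ≤ 2 * (k * (j₁ - j₀ + 2)) := by
        rw [mul_left_comm]
        exact Nat.mul_le_mul_left _ (by omega)
      rw [add_mul] at f4 ⊢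
      omega
  have := Nat.mul_le_mul_right (2 * κ₀ + 62) hk
  have := Nat.mul_le_mul_left κ₁ (show 8 * (i₁ - i₀ + (j₁ - j₀) + 4) ≤
    8 * (l₁ - l₀ + (r₁ - r₀) + 4) by omega)
  simp [Expr.cost, Expr.cost_mod2]
  omega

/-- The detection algorithm. The answer is no unless `L` lies on the left of `R`. -/
def detect (q₁ q₂ : Prog) : Prog :=
  .seq (.ite (.lt (.var 2) (.var 3))
    (.seq (paritySearch q₁ q₂ 0) (paritySearch q₁ q₂ 1)) .skip) <|
  .assign 0 (.var 9)

theorem run_detect (O : Oracles w n z A bit κ₀ κ₁ q₁ q₂) {N : ℕ}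
    (hl₀ : 1 ≤ l₀) (hl : l₀ ≤ l₁) (hl₁ : l₁ ≤ n) (hr₀ : 1 ≤ r₀) (hr : r₀ ≤ r₁) (hr₁ : r₁ ≤ n)
    (hN₁ : ∀ k, k * (l₁ - l₀ + 1) ≤ 2 * (r₁ - r₀ + 1) + 3 * (l₁ - l₀ + 1) → k ≤ N)
    (hN₂ : ∀ k, k * (r₁ - r₀ + 1) ≤ 2 * (l₁ - l₀ + 1) + 3 * (r₁ - r₀ + 1) → k ≤ N)
    {s : State} (hA : s.arr = A) (h0 : s.reg 0 = z) (h1 : s.reg 1 = l₀) (h2 : s.reg 2 = l₁)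
    (h3 : s.reg 3 = r₀) (h4 : s.reg 4 = r₁) (h9 : s.reg 9 = 0) :
    Run w (detect q₁ q₂) s fun t s' =>
      (s'.reg 0 ≠ 0 ↔ l₁ < r₀ ∧ ∃ p ≤ 1, HasParityCadence bit l₀ l₁ r₀ r₁ p) ∧
      t ≤ N * (4 * κ₀ + 124) + 16 * κ₀ + 820 + κ₁ * (16 * (l₁ - l₀ + (r₁ - r₀) + 4)) := by
  have hW := O.room
  have hw := O.pos
  have hκ : κ₁ * (16 * (l₁ - l₀ + (r₁ - r₀) + 4)) =
    κ₁ * (8 * (l₁ - l₀ + (r₁ - r₀) + 4)) + κ₁ * (8 * (l₁ - l₀ + (r₁ - r₀) + 4)) := by ring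
  have hN : N * (4 * κ₀ + 124) = N * (2 * κ₀ + 62) + N * (2 * κ₀ + 62) := by ring
  refine .seq (.ite (by simp [Expr.Fits, h2, h3]; omega) (fun h => ?_) (fun h => ?_))
  · simp [Expr.eval, h2, h3] at h
    refine .seq ((run_paritySearch O (Nat.zero_le 1) hl₀ hl hl₁ hr₀ hr hr₁ hN₁ hN₂ hA h0 h1 h2 h3
      h4).mono ?_)
    rintro t s₁ ⟨f1, f2, f3, f4⟩
    refine (run_paritySearch O le_rfl hl₀ hl hl₁ hr₀ hr hr₁ hN₁ hN₂ f2 (by rw [f1 _ (by simp), h0])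
      (by rw [f1 _ (by simp), h1]) (by rw [f1 _ (by simp), h2]) (by rw [f1 _ (by simp), h3])
      (by rw [f1 _ (by simp), h4])).mono ?_
    rintro t' s₂ ⟨g1, g2, g3, g4⟩
    have hle : s₂.reg 9 ≤ 1 := by omega
    refine .assign (by simp [Expr.Fits]; omega) ⟨?_, ?_⟩
    · have hex : (∃ p ≤ 1, HasParityCadence bit l₀ l₁ r₀ r₁ p) ↔
          HasParityCadence bit l₀ l₁ r₀ r₁ 0 ∨ HasParityCadence bit l₀ l₁ r₀ r₁ 1 := by
        constructor
        · rintro ⟨p, hp, hp'⟩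
          interval_cases p
          exacts [.inl hp', .inr hp']
        · rintro (hp | hp)
          exacts [⟨0, by simp, hp⟩, ⟨1, by simp, hp⟩]
      rw [hex]
      simp only [setReg_reg, if_true, Expr.eval]
      rcases f3 with ⟨f3, f5⟩ | ⟨f3, f5⟩ <;> rcases g3 with ⟨g3, g5⟩ | ⟨g3, g5⟩ <;>
        simp [*]
    · simp only [Expr.cost]
      omega
  · simp [Expr.eval, h2, h3] at h
    refine .skip (.assign (by simp [Expr.Fits, h9]) ⟨?_, ?_⟩)
    · simp [Expr.eval, h9, Nat.not_lt.mpr h]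
    · simp only [Expr.cost]
      omega

end Detect

end WordRAM

namespace WordRAM

/-! ### Uncompressed strings -/

/-- Linear search with step `k` in array `0`. -/
def scan (k : ℕ) : Prog :=
  .seq (.assign 23 (.var 20)) <|
  .loop (.sub (.add (.lt (.var 23) (.add (.var 21) (.const 1)))
      (.add (.sub (.get 0 (.var 23)) (.var 22)) (.sub (.var 22) (.get 0 (.var 23))))) (.const 1))
    (.assign 23 (.add (.var 23) (.const k)))

theorem searches_scan {w n z k : ℕ} {A : ℕ → ℕ → ℕ} (hk : k = 1 ∨ k = 2)
    (hW : 8 * (n + 4) ≤ 2 ^ w) (hbit : ∀ x, A 0 x ≤ 1) :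
    Searches w n z A (A 0) 80 25 k (scan k) := by
  have hw : w ≠ 0 := by rintro rfl; omega
  intro s hA h0 h1 hab hn hc
  obtain ⟨a, ha⟩ : ∃ a, a = s.reg 20 := ⟨_, rfl⟩
  obtain ⟨b, hb⟩ : ∃ b, b = s.reg 21 := ⟨_, rfl⟩
  obtain ⟨c, hc'⟩ : ∃ c, c = s.reg 22 := ⟨_, rfl⟩
  rw [← ha] at h1
  rw [← ha, ← hb] at hab
  rw [← hb] at hn
  rw [← hc'] at hc
  rw [← ha, ← hb, ← hc']
  refine .seq (.assign (by simp [Expr.Fits]; omega) ?_)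
  simp only [Expr.eval]
  -- the loop, started at an index `r` before which nothing has been found
  have key : ∀ d r (s₁ : State), d = b + 2 - r → r ≤ b + 2 → a ≤ r → r % k = a % k →
      (∀ x, a ≤ x → x < r → x ≤ b → x % k = a % k → A 0 x ≠ c) →
      s₁.arr = A → (∀ x < 23, s₁.reg x = s.reg x) → s₁.reg 23 = r →
      Run w (.loop (.sub (.add (.lt (.var 23) (.add (.var 21) (.const 1)))
        (.add (.sub (.get 0 (.var 23)) (.var 22)) (.sub (.var 22) (.get 0 (.var 23)))))
          (.const 1)) (.assign 23 (.add (.var 23) (.const k)))) s₁ fun t s' =>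
        s'.arr = A ∧ (∀ x < 20, s'.reg x = s.reg x) ∧ IsNext (A 0) k c a b (s'.reg 23) ∧
        s'.reg 23 ≤ n + 2 ∧ r ≤ s'.reg 23 ∧ t ≤ 20 + 25 * (min (s'.reg 23) (b + 2) - r) := by
    intro d
    induction d using Nat.strong_induction_on with
    | _ d ih =>
      intro r s₁ hd hrb har hrk hnone hA₁ hf₁ h23
      have hr1 := hbit r
      refine .loop ?_ (fun h => .assign ?_ ?_) (fun h => ?_)
      · simp [Expr.Fits, Expr.eval, h23, hf₁, hA₁, ← hb, ← hc']
        split_ifs <;> omega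
      · simp [Expr.Fits, Expr.eval, h23]
        omega
      · simp [Expr.eval, h23, hf₁, hA₁, ← hb, ← hc'] at h
        have hrb' : r ≤ b := by
          by_contra hcon
          rw [if_neg (by omega)] at h
          omega
        rw [if_pos (by omega)] at h
        refine (ih (b + 2 - (r + k)) (by omega) (r + k) _ rfl (by omega) (by omega) (by simp [hrk])
          ?_ (by simpa using hA₁) (fun x hx => ?_) (by simp [Expr.eval, h23])).mono ?_
        · intro x g1 g2 g3 g4
          rcases Nat.lt_or_ge x r with g5 | g5
          · exact hnone x g1 g5 g3 g4
          · obtain rfl : x = r := by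
              rcases hk with rfl | rfl <;> omega
            omega
        · simp [hf₁ x hx, show x ≠ 23 by omega]
        · rintro t s' ⟨g1, g2, g3, g4, g5, g6⟩
          refine ⟨g1, g2, g3, g4, by omega, ?_⟩
          simp only [Expr.cost]
          have : r + k ≤ b + 2 := by omega
          omega
      · simp [Expr.eval, h23, hf₁, hA₁, ← hb, ← hc'] at h
        refine ⟨hA₁, fun x hx => hf₁ x (by omega), ?_, by omega, by omega, ?_⟩
        · rw [h23]
          refine ⟨har, hnone, fun g => ⟨?_, hrk⟩⟩
          rw [if_pos (by omega)] at h
          omega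
        · simp only [Expr.cost]
          omega
  refine (key _ a _ rfl (by omega) le_rfl rfl (fun x _ _ => by omega) (by simpa using hA)
    (fun x hx => by simp [show x ≠ 23 by omega]) (by simp [← ha])).mono ?_
  rintro t s' ⟨g1, g2, g3, g4, g5, g6⟩
  refine ⟨g1, g2, g3, g4, ?_⟩
  simp only [Expr.cost]
  omega

end WordRAM

/-- The bit at index `i`, which is `0` outside the string. -/
def bitAt (S : List Bool) (i : ℕ) : ℕ := if charAt S i = some true then 1 else 0

theorem bitAt_le (S : List Bool) (i : ℕ) : bitAt S i ≤ 1 := by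
  unfold bitAt
  split_ifs <;> simp

theorem charAt_eq_some_iff {S : List Bool} {i : ℕ} (h₁ : 1 ≤ i) (h₂ : i ≤ S.length) (b : Bool) :
    charAt S i = some b ↔ bitAt S i = b.toNat := by
  have h : charAt S i = some (S[i - 1]'(by omega)) := by
    simp [charAt, show i ≠ 0 by omega, List.getElem?_eq_getElem (show i - 1 < S.length by omega)]
  rw [bitAt, h]
  cases S[i - 1] <;> cases b <;> simp

theorem hasLRCadence_iff (S : List Bool) (I : IntervalPair S.length) :
    HasLRCadence S I.L I.R 3 ↔ I.lmax < I.rmin ∧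
      ∃ p ≤ 1, WordRAM.HasParityCadence (bitAt S) I.lmin I.lmax I.rmin I.rmax p := by
  have h1 := I.one_le_lmin
  have h2 := I.lmin_le_lmax
  have h3 := I.lmax_le
  have h4 := I.one_le_rmin
  have h5 := I.rmin_le_rmax
  have h6 := I.rmax_le
  constructor
  · rintro ⟨i, d, ⟨hd, c, hc⟩, hi, hj⟩
    simp only [IntervalPair.L, IntervalPair.R, Finset.mem_Icc] at hi hj
    have hlr : I.lmax < I.rmin := by
      by_contra hcon
      have hdisj := I.disj
      rw [Finset.disjoint_left] at hdisj
      rcases Nat.lt_or_ge I.rmax I.lmin with h | h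
      · omega
      · exact hdisj (a := max I.lmin I.rmin) (by simp; omega) (by simp; omega)
    have e0 := hc 0 (by simp)
    have e1 := hc 1 (by simp)
    have e2 := hc 2 (by simp)
    rw [charAt_eq_some_iff (by omega) (by omega)] at e0 e1 e2
    refine ⟨hlr, i % 2, by omega, i, i + 2 * d, hi.1, hi.2, hj.1, hj.2, rfl, by omega, ?_, ?_⟩
    · simpa using e0.trans e2.symm
    · rw [show (i + (i + 2 * d)) / 2 = i + 1 * d by omega, e1, ← e0]
      simp
  · rintro ⟨hlr, p, hp, i, j, g1, g2, g3, g4, g5, g6, g7, g8⟩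
    obtain ⟨d, rfl⟩ : ∃ d, j = i + 2 * d := ⟨(j - i) / 2, by omega⟩
    rw [show (i + (i + 2 * d)) / 2 = i + d by omega] at g8
    have hb : ∃ b : Bool, bitAt S i = b.toNat := by
      have := bitAt_le S i
      rcases (show bitAt S i = 0 ∨ bitAt S i = 1 by omega) with h | h
      exacts [⟨false, h⟩, ⟨true, h⟩]
    obtain ⟨b, hb⟩ := hb
    refine ⟨i, d, ⟨by omega, b, fun j hj => ?_⟩, ?_, ?_⟩
    · interval_cases j
      · rw [charAt_eq_some_iff (by omega) (by omega)]
        simpa using hb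
      · rw [charAt_eq_some_iff (by omega) (by omega), one_mul, g8, hb]
      · rw [charAt_eq_some_iff (by omega) (by omega), ← g7, hb]
    · simp [IntervalPair.L, g1, g2]
    · simp [IntervalPair.R, g3, g4]

theorem le_of_mul_le_length {a b k : ℕ} (ha : 0 < a) (h : k * a ≤ 2 * b + 3 * a) :
    k ≤ 2 * b / a + 3 := by
  rw [← Nat.add_mul_div_right _ _ ha]
  exact (Nat.le_div_iff_mul_le ha).mpr h

theorem IntervalPair.card_L {n : ℕ} (I : IntervalPair n) : I.L.card = I.lmax - I.lmin + 1 := by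
  have := I.lmin_le_lmax
  simp [IntervalPair.L]
  omega

theorem IntervalPair.card_R {n : ℕ} (I : IntervalPair n) : I.R.card = I.rmax - I.rmin + 1 := by
  have := I.rmin_le_rmax
  simp [IntervalPair.R]
  omega

/-- The detection algorithm with linear search is linear. -/
theorem exists_linear_prog : ∃ (p : WordRAM.Prog) (c : ℕ),
    ∀ (S : List Bool) (I : IntervalPair S.length),
      WordRAM.Decides p (stringInput S I) (HasLRCadence S I.L I.R 3)
        (c * (I.L.card + I.R.card)) (c * (Nat.log 2 S.length + 1)) := by
  refine ⟨WordRAM.detect (WordRAM.scan 1) (WordRAM.scan 2), 10000, fun S I => ?_⟩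
  have h1 := I.one_le_lmin
  have h2 := I.lmin_le_lmax
  have h3 := I.lmax_le
  have h4 := I.one_le_rmin
  have h5 := I.rmin_le_rmax
  have h6 := I.rmax_le
  rw [I.card_L, I.card_R]
  have harr : (stringInput S I).arr 0 = bitAt S := by
    funext i
    simp [stringInput, bitAt]
  obtain ⟨w, hw⟩ : ∃ w, w = 10000 * (Nat.log 2 S.length + 1) := ⟨_, rfl⟩
  have hW : 8 * (S.length + 4) ≤ 2 ^ w := by
    have g1 := Nat.lt_pow_succ_log_self (b := 2) (by simp) S.length
    have g2 : 2 ^ (Nat.log 2 S.length + 1) * 2 ^ 6 ≤ 2 ^ w := by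
      rw [← pow_add]
      exact Nat.pow_le_pow_right (by simp) (by omega)
    omega
  have hO (z : ℕ) : WordRAM.Oracles w S.length z (stringInput S I).arr (bitAt S) 80 25
      (WordRAM.scan 1) (WordRAM.scan 2) :=
    ⟨harr ▸ WordRAM.searches_scan (.inl rfl) hW (by rw [harr]; exact bitAt_le S),
      harr ▸ WordRAM.searches_scan (.inr rfl) hW (by rw [harr]; exact bitAt_le S),
      bitAt_le S, hW⟩
  rw [← hw]
  obtain ⟨t, s', g1, g2, g3⟩ := WordRAM.run_detect (hO S.length) h1 h2 h3 h4 h5 h6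
    (N := 2 * (I.rmax - I.rmin + 1) + 2 * (I.lmax - I.lmin + 1) + 3)
    (fun k hk => (le_of_mul_le_length (by omega) hk).trans
      (by have := Nat.div_le_self (2 * (I.rmax - I.rmin + 1)) (I.lmax - I.lmin + 1); omega))
    (fun k hk => (le_of_mul_le_length (by omega) hk).trans
      (by have := Nat.div_le_self (2 * (I.lmax - I.lmin + 1)) (I.rmax - I.rmin + 1); omega))
    (s := stringInput S I) rfl rfl rfl rfl rfl rfl rfl
  refine ⟨t, s', g1, ?_, by rw [g2, hasLRCadence_iff]⟩
  norm_num at g3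
  generalize I.lmax - I.lmin = a at *
  generalize I.rmax - I.rmin = b at *
  linarith

/-! ### Tables for grammar-compressed strings -/

theorem bitAt_append_left {l₁ l₂ : List Bool} {q : ℕ} (h : q ≤ l₁.length) :
    bitAt (l₁ ++ l₂) q = bitAt l₁ q := by
  rcases Nat.eq_zero_or_pos q with rfl | hq
  · simp [bitAt, charAt]
  · simp [bitAt, charAt, List.getElem?_append_left (show q - 1 < l₁.length by omega)]

theorem bitAt_append_right {l₁ l₂ : List Bool} {q : ℕ} (h : 1 ≤ q) :
    bitAt (l₁ ++ l₂) (l₁.length + q) = bitAt l₂ q := by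
  simp [bitAt, charAt, show q ≠ 0 by omega,
    List.getElem?_append_right (show l₁.length ≤ l₁.length + q - 1 by omega),
    show l₁.length + q - 1 - l₁.length = q - 1 by omega]

theorem bitAt_singleton (b : Bool) : bitAt [b] 1 = b.toNat := by
  cases b <;> simp [bitAt, charAt]

/-- `v` is the first index of parity `p` at which the string `l` has the bit `c`; it is `0` if
there is none. -/
structure FirstAt (l : List Bool) (c p v : ℕ) : Prop where
  none : v = 0 → ∀ q, 1 ≤ q → q ≤ l.length → q % 2 = p → bitAt l q ≠ c
  some : v ≠ 0 → v ≤ l.length ∧ v % 2 = p ∧ bitAt l v = c ∧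
    ∀ q, 1 ≤ q → q < v → q % 2 = p → bitAt l q ≠ c

theorem FirstAt.le {l : List Bool} {c p v : ℕ} (h : FirstAt l c p v) : v ≤ l.length := by
  by_cases hv : v = 0
  · omega
  · exact (h.some hv).1

theorem FirstAt.append_left {l₁ l₂ : List Bool} {c p v : ℕ} (h : FirstAt l₁ c p v) (hv : v ≠ 0) :
    FirstAt (l₁ ++ l₂) c p v := by
  obtain ⟨h1, h2, h3, h4⟩ := h.some hv
  refine ⟨fun h => absurd h hv, fun _ => ⟨by simp; omega, h2, by rwa [bitAt_append_left h1], ?_⟩⟩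
  intro q g1 g2 g3
  rw [bitAt_append_left (by omega)]
  exact h4 q g1 g2 g3

theorem FirstAt.append_right {l₁ l₂ : List Bool} {c p v : ℕ} (hp : p ≤ 1)
    (h₁ : FirstAt l₁ c p 0) (h₂ : FirstAt l₂ c ((p + l₁.length) % 2) v) :
    FirstAt (l₁ ++ l₂) c p (if v = 0 then 0 else l₁.length + v) := by
  have hnone := h₁.none rfl
  have key : ∀ q, 1 ≤ q → q % 2 = p → (l₁.length < q → bitAt l₂ (q - l₁.length) ≠ c) →
      bitAt (l₁ ++ l₂) q ≠ c := by
    intro q g1 g2 g3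
    rcases Nat.lt_or_ge l₁.length q with g4 | g4
    · rw [show q = l₁.length + (q - l₁.length) by omega, bitAt_append_right (by omega)]
      exact g3 g4
    · rw [bitAt_append_left g4]
      exact hnone q g1 g4 g2
  by_cases hv : v = 0
  · rw [if_pos hv]
    refine ⟨fun _ q g1 g2 g3 => key q g1 g3 fun g4 => ?_, fun h => absurd rfl h⟩
    rw [List.length_append] at g2
    exact h₂.none hv (q - l₁.length) (by omega) (by omega) (by omega)
  · rw [if_neg hv]
    obtain ⟨h1, h2, h3, h4⟩ := h₂.some hv
    refine ⟨fun h => by omega, fun _ => ⟨by simp; omega, by omega, ?_, ?_⟩⟩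
    · rwa [bitAt_append_right (by omega)]
    · exact fun q g1 g2 g3 => key q g1 g3 fun g4 =>
        h4 (q - l₁.length) (by omega) (by omega) (by omega)

theorem FirstAt.singleton (b : Bool) {c p : ℕ} (hc : c ≤ 1) (hp : p ≤ 1) :
    FirstAt [b] c p (if p = 0 then 0 else if c = 0 then 1 - b.toNat else b.toNat) := by
  constructor
  · intro h q g1 g2 g3
    obtain rfl : q = 1 := by simp at g2; omega
    obtain rfl : p = 1 := by omega
    rw [bitAt_singleton]
    cases b <;> interval_cases c <;> simp at *
  · intro h
    obtain rfl : p = 1 := by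
      by_contra hcon
      simp [show p = 0 by omega] at h
    have hv : (if 1 = 0 then 0 else if c = 0 then 1 - b.toNat else b.toNat) = 1 := by
      cases b <;> interval_cases c <;> simp at *
    rw [hv]
    refine ⟨by simp, rfl, ?_, fun q _ _ => by omega⟩
    rw [bitAt_singleton]
    cases b <;> interval_cases c <;> simp at *

/-- The arrays `0, 1, 2` of `B` describe a grammar with `m` nonterminals that derive the strings
`E 0, E 1, …`, whose lengths and number are at most `M`. -/
structure Describes (B : ℕ → ℕ → ℕ) (E : ℕ → List Bool) (m M : ℕ) : Prop where
  rule : ∀ i < m, (∃ b : Bool, B 0 i = b.toNat ∧ E i = [b]) ∨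
    (B 0 i = 2 ∧ B 1 i < i ∧ B 2 i < i ∧ E i = E (B 1 i) ++ E (B 2 i))
  length_le : ∀ i < m, (E i).length ≤ M
  size_le : m ≤ M

namespace WordRAM

/-- The arrays hold, in addition to the rules `B` of a grammar, the tables for its first `m`
nonterminals: the lengths of the derived strings in array `3`, and the first index at which the
string derived from `v_i` has the bit `c` and which has the parity `p`, in the cell `4i + 2c + p`
of array `4`. -/
structure Tables (B A : ℕ → ℕ → ℕ) (E : ℕ → List Bool) (m : ℕ) : Prop where
  rules : ∀ a < 3, A a = B a
  length : ∀ i < m, A 3 i = (E i).length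
  first : ∀ i < m, ∀ c ≤ 1, ∀ p ≤ 1, FirstAt (E i) c p (A 4 (4 * i + 2 * c + p))

/-- The address `4i + 2c + p`. -/
def tableAddr (i c p : Expr) : Expr :=
  .add (.add (.add i i) (.add i i)) (.add (.add c c) p)

/-- Computes the cell `(c, p)` of array `4` for the nonterminal in register `24`, whose rule is
the pair in the registers `25` and `26`; the length of the left part is in register `27`. -/
def firstEntry (c p : ℕ) : Prog :=
  .seq (.assign 28 (.get 4 (tableAddr (.var 25) (.const c) (.const p)))) <|
  .ite (.var 28) (.store 4 (tableAddr (.var 24) (.const c) (.const p)) (.var 28)) <|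
  .seq (.assign 28 (.get 4 (tableAddr (.var 26) (.const c)
    (Expr.mod2 (.add (.const p) (.var 27)))))) <|
  .ite (.var 28)
    (.store 4 (tableAddr (.var 24) (.const c) (.const p)) (.add (.var 27) (.var 28)))
    (.store 4 (tableAddr (.var 24) (.const c) (.const p)) (.const 0))

variable {w m M : ℕ} {B : ℕ → ℕ → ℕ} {E : ℕ → List Bool}

theorem run_firstEntry {i j k c p : ℕ} (hc : c ≤ 1) (hp : p ≤ 1) (hW : 8 * (M + 4) ≤ 2 ^ w)
    {s : State} (hi : i < M) (hj : j < i) (hk : k < i) (hE : E i = E j ++ E k)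
    (hM : (E i).length ≤ M) (h24 : s.reg 24 = i) (h25 : s.reg 25 = j)
    (h26 : s.reg 26 = k) (h27 : s.reg 27 = (E j).length)
    (hfj : ∀ c ≤ 1, ∀ p ≤ 1, FirstAt (E j) c p (s.arr 4 (4 * j + 2 * c + p)))
    (hfk : ∀ c ≤ 1, ∀ p ≤ 1, FirstAt (E k) c p (s.arr 4 (4 * k + 2 * c + p))) :
    Run w (firstEntry c p) s fun t s' => t ≤ 200 ∧ (∀ x, x ≠ 28 → s'.reg x = s.reg x) ∧
      ∃ v, FirstAt (E i) c p v ∧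
        ∀ a y, s'.arr a y = if a = 4 ∧ y = 4 * i + 2 * c + p then v else s.arr a y := by
  have hw : w ≠ 0 := by rintro rfl; omega
  have hlen : (E i).length = (E j).length + (E k).length := by rw [hE, List.length_append]
  have hmod (e : Expr) (s : State) (h : e.Fits w s) (h' : e.eval s < 2 ^ w) :
    e.mod2.Fits w s := Expr.fits_mod2 h h'
  have e1 (i c p : ℕ) : i + i + (i + i) + (c + c + p) = 4 * i + 2 * c + p := by ring
  have hv₁ := hfj c hc p hp
  have hv₂ := hfk c hc ((p + (E j).length) % 2) (by omega)
  generalize hv : s.arr 4 (4 * j + 2 * c + p) = v₁ at *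
  generalize hv' : s.arr 4 (4 * k + 2 * c + (p + (E j).length) % 2) = v₂ at *
  have l1 := hv₁.le
  have l2 := hv₂.le
  refine .seq (.assign ?_ (.ite ?_ (fun h => .store ?_ ?_ ?_) (fun h => .seq (.assign ?_
    (.ite ?_ (fun h' => .store ?_ ?_ ?_) (fun h' => .store ?_ ?_ ?_))))))
  · simp [Expr.Fits, tableAddr, Expr.eval, h25, e1, hv]
    omega
  · simp [Expr.Fits, Expr.eval, tableAddr, h25, e1, hv]
    omega
  · simp [Expr.Fits, tableAddr, Expr.eval, h24]
    omega
  · simp [Expr.Fits, Expr.eval, tableAddr, h25, e1, hv]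
    omega
  · simp [Expr.eval, tableAddr, h25, e1, hv] at h
    refine ⟨by simp [Expr.cost, tableAddr], fun x hx => by simp [hx], v₁, ?_, ?_⟩
    · rw [hE]
      exact hv₁.append_left h
    · intro a y
      simp [Expr.eval, tableAddr, h24, h25, e1, hv]
  · simp [Expr.eval, tableAddr, h25, e1, hv] at h
    refine ⟨⟨⟨⟨?_, ?_, ?_⟩, ⟨?_, ?_, ?_⟩, ?_⟩, ⟨⟨?_, ?_, ?_⟩, hmod _ _ ?_ ?_, ?_⟩, ?_⟩, ?_⟩
    all_goals simp [Expr.Fits, tableAddr, Expr.eval, Expr.eval_mod2, h26, h27, e1, hv']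
    all_goals omega
  · simp [Expr.Fits, tableAddr, Expr.eval, Expr.eval_mod2, h26, h27, e1, hv']
    omega
  · simp [Expr.Fits, tableAddr, Expr.eval, h24]
    omega
  · simp [Expr.Fits, tableAddr, Expr.eval, Expr.eval_mod2, h26, h27, e1, hv']
    omega
  · simp [Expr.eval, tableAddr, h25, e1, hv] at h
    simp [Expr.eval, tableAddr, Expr.eval_mod2, h26, h27, e1, hv'] at h'
    refine ⟨by simp [Expr.cost, tableAddr, Expr.cost_mod2], fun x hx => by simp [hx],
      (E j).length + v₂, ?_, ?_⟩
    · rw [hE]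
      have := FirstAt.append_right hp (h ▸ hv₁) hv₂
      rwa [if_neg h'] at this
    · intro a y
      simp [Expr.eval, tableAddr, Expr.eval_mod2, h24, h26, h27, e1, hv']
  · simp [Expr.Fits, tableAddr, Expr.eval, h24]
    omega
  · simp [Expr.Fits]
  · simp [Expr.eval, tableAddr, h25, e1, hv] at h
    simp [Expr.eval, tableAddr, Expr.eval_mod2, h26, h27, e1, hv'] at h'
    refine ⟨by simp [Expr.cost, tableAddr, Expr.cost_mod2], fun x hx => by simp [hx], 0, ?_, ?_⟩
    · rw [hE]
      have := FirstAt.append_right hp (h ▸ hv₁) hv₂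
      rwa [if_pos h'] at this
    · intro a y
      simp [Expr.eval, tableAddr, h24, e1]

end WordRAM

/-! ### Computation of the tables -/

namespace WordRAM

variable {w m M : ℕ} {B : ℕ → ℕ → ℕ} {E : ℕ → List Bool}

/-- Computes the cells of the tables for the nonterminal in register `24`. -/
def tableEntry : Prog :=
  .ite (.lt (.get 0 (.var 24)) (.const 2))
    (.seq (.store 3 (.var 24) (.const 1)) <|
      .seq (.store 4 (tableAddr (.var 24) (.const 0) (.const 0)) (.const 0)) <|
      .seq (.store 4 (tableAddr (.var 24) (.const 0) (.const 1))
        (.sub (.const 1) (.get 0 (.var 24)))) <|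
      .seq (.store 4 (tableAddr (.var 24) (.const 1) (.const 0)) (.const 0)) <|
      .store 4 (tableAddr (.var 24) (.const 1) (.const 1)) (.get 0 (.var 24)))
    (.seq (.assign 25 (.get 1 (.var 24))) <|
      .seq (.assign 26 (.get 2 (.var 24))) <|
      .seq (.assign 27 (.get 3 (.var 25))) <|
      .seq (.store 3 (.var 24) (.add (.var 27) (.get 3 (.var 26)))) <|
      .seq (firstEntry 0 0) <| .seq (firstEntry 0 1) <|
      .seq (firstEntry 1 0) (firstEntry 1 1))

/-- The program that computes the tables. -/
def buildTables : Prog :=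
  .seq (.assign 24 (.const 0)) <|
  .loop (.lt (.var 24) (.var 0)) (.seq tableEntry (.assign 24 (.add (.var 24) (.const 1))))

/-- Writing into the cells of a further nonterminal keeps the tables and extends them. -/
theorem Tables.extend {A A' : ℕ → ℕ → ℕ} {i : ℕ} (h : Tables B A E i)
    (hother : ∀ a y, ¬ (a = 3 ∧ y = i) → ¬ (a = 4 ∧ 4 * i ≤ y) → A' a y = A a y)
    (hlen : A' 3 i = (E i).length)
    (hfirst : ∀ c ≤ 1, ∀ p ≤ 1, FirstAt (E i) c p (A' 4 (4 * i + 2 * c + p))) :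
    Tables B A' E (i + 1) := by
  refine ⟨fun a ha => ?_, fun x hx => ?_, fun x hx c hc p hp => ?_⟩
  · rw [← h.rules a ha]
    funext y
    exact hother a y (by omega) (by omega)
  · by_cases hxi : x = i
    · rw [hxi, hlen]
    · rw [hother 3 x (by omega) (by omega), h.length x (by omega)]
  · by_cases hxi : x = i
    · rw [hxi]
      exact hfirst c hc p hp
    · rw [hother 4 _ (by omega) (by omega)]
      exact h.first x (by omega) c hc p hp

theorem run_tableEntry (D : Describes B E m M) (hW : 8 * (M + 4) ≤ 2 ^ w) {s : State} {i : ℕ}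
    (hi : i < m) (h24 : s.reg 24 = i) (hT : Tables B s.arr E i) :
    Run w tableEntry s fun t s' => t ≤ 1000 ∧ (∀ x < 25, s'.reg x = s.reg x) ∧
      Tables B s'.arr E (i + 1) := by
  have hw : w ≠ 0 := by rintro rfl; omega
  have hm := D.size_le
  have e1 (i c p : ℕ) : i + i + (i + i) + (c + c + p) = 4 * i + 2 * c + p := by ring
  have e2 (i : ℕ) : i + i + (i + i) = 4 * i := by ring
  have hB (a : ℕ) (ha : a < 3) (y : ℕ) : s.arr a y = B a y := by rw [hT.rules a ha]
  have hle := D.length_le i hi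
  rcases D.rule i hi with ⟨b, hb, hE⟩ | ⟨h0, hj, hk, hE⟩
  · have hb1 : b.toNat ≤ 1 := by cases b <;> simp
    refine .ite ?_ (fun h => ?_) (fun h => ?_)
    · simp [Expr.Fits, Expr.eval, h24, hB, hb]
      omega
    · refine .seq <| .store ?_ ?_ <| .seq <| .store ?_ ?_ <| .seq <| .store ?_ ?_ <|
        .seq <| .store ?_ ?_ <| .store ?_ ?_ ⟨?_, fun x hx => rfl, ?_⟩
      iterate 10
        · simp [Expr.Fits, Expr.eval, tableAddr, h24, hB, hb]
          try omega
      · simp [Expr.cost, tableAddr]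
      · refine hT.extend (fun a y g1 g2 => ?_) ?_ (fun c hc p hp => ?_)
        · simp only [setCell_arr, tableAddr, Expr.eval, setCell_reg, h24, e1]
          rw [if_neg (by omega), if_neg (by omega), if_neg (by omega), if_neg (by omega),
            if_neg (by omega)]
        · simp [Expr.eval, h24, hE]
        · rw [hE]
          convert FirstAt.singleton b hc hp using 1
          interval_cases c <;> interval_cases p <;>
            simp [tableAddr, Expr.eval, h24, e2, hB, hb]
    · simp [Expr.eval, h24, hB, hb] at h
      omega
  · have hj' := hT.length _ hj
    have hk' := hT.length _ hk
    generalize hjj : B 1 i = j at *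
    generalize hkk : B 2 i = k at *
    have hlen : (E i).length = (E j).length + (E k).length := by rw [hE, List.length_append]
    refine .ite ?_ (fun h => ?_) (fun h => ?_)
    · simp [Expr.Fits, Expr.eval, h24, hB, h0]
      omega
    · simp [Expr.eval, h24, hB, h0] at h
    refine .seq <| .assign ?_ <| .seq <| .assign ?_ <| .seq <| .assign ?_ <| .seq <| .store ?_ ?_ ?_
    iterate 5
      · simp [Expr.Fits, Expr.eval, h24, hB, hjj, hkk, hj', hk']
        omega
    generalize hs₁ : State.setCell _ _ _ _ = s₁
    have g24 : s₁.reg 24 = i := by simp [← hs₁, h24]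
    have g25 : s₁.reg 25 = j := by simp [← hs₁, Expr.eval, h24, hB, hjj]
    have g26 : s₁.reg 26 = k := by simp [← hs₁, Expr.eval, h24, hB, hkk]
    have g27 : s₁.reg 27 = (E j).length := by simp [← hs₁, Expr.eval, h24, hB, hjj, hj']
    have gf : ∀ x < 25, s₁.reg x = s.reg x := fun x hx => by
      simp [← hs₁, show x ≠ 25 by omega, show x ≠ 26 by omega, show x ≠ 27 by omega]
    have gA (a y : ℕ) : s₁.arr a y = if a = 3 ∧ y = i then (E i).length else s.arr a y := by
      simp [← hs₁, Expr.eval, h24, hB, hjj, hkk, hj', hk', hlen]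
    clear hs₁
    -- the entries of the two parts lie in cells that are not overwritten
    have old (s' : State) (h : ∀ y < 4 * i, s'.arr 4 y = s₁.arr 4 y) (x : ℕ) (hx : x < i) (c : ℕ)
        (hc : c ≤ 1) (p : ℕ) (hp : p ≤ 1) :
        FirstAt (E x) c p (s'.arr 4 (4 * x + 2 * c + p)) := by
      rw [h _ (by omega), gA, if_neg (by omega)]
      exact hT.first x hx c hc p hp
    refine .seq ((run_firstEntry (c := 0) (p := 0) (by omega) (by omega) hW (by omega) hj hk hE hle
      g24 g25 g26 g27 (old s₁ (fun _ _ => rfl) j hj) (old s₁ (fun _ _ => rfl) k hk)).mono ?_)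
    rintro t₂ s₂ ⟨ht₂, hf₂, v₂, hv₂, hA₂⟩
    have hA₂' : ∀ y < 4 * i, s₂.arr 4 y = s₁.arr 4 y := fun y hy => by
      rw [hA₂, if_neg (by omega)]
    refine .seq ((run_firstEntry (c := 0) (p := 1) (by omega) (by omega) hW (by omega) hj hk hE hle
      (by simp [hf₂, g24]) (by simp [hf₂, g25]) (by simp [hf₂, g26]) (by simp [hf₂, g27])
      (old s₂ hA₂' j hj) (old s₂ hA₂' k hk)).mono ?_)
    rintro t₃ s₃ ⟨ht₃, hf₃, v₃, hv₃, hA₃⟩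
    have hA₃' : ∀ y < 4 * i, s₃.arr 4 y = s₁.arr 4 y := fun y hy => by
      rw [hA₃, if_neg (by omega), hA₂' y hy]
    refine .seq ((run_firstEntry (c := 1) (p := 0) (by omega) (by omega) hW (by omega) hj hk hE hle
      (by simp [hf₃, hf₂, g24]) (by simp [hf₃, hf₂, g25]) (by simp [hf₃, hf₂, g26])
      (by simp [hf₃, hf₂, g27]) (old s₃ hA₃' j hj) (old s₃ hA₃' k hk)).mono ?_)
    rintro t₄ s₄ ⟨ht₄, hf₄, v₄, hv₄, hA₄⟩
    have hA₄' : ∀ y < 4 * i, s₄.arr 4 y = s₁.arr 4 y := fun y hy => by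
      rw [hA₄, if_neg (by omega), hA₃' y hy]
    refine (run_firstEntry (c := 1) (p := 1) (by omega) (by omega) hW (by omega) hj hk hE hle
      (by simp [hf₄, hf₃, hf₂, g24]) (by simp [hf₄, hf₃, hf₂, g25])
      (by simp [hf₄, hf₃, hf₂, g26]) (by simp [hf₄, hf₃, hf₂, g27]) (old s₄ hA₄' j hj)
      (old s₄ hA₄' k hk)).mono ?_
    rintro t₅ s₅ ⟨ht₅, hf₅, v₅, hv₅, hA₅⟩
    refine ⟨by simp [Expr.cost]; omega, fun x hx => ?_, hT.extend (fun a y g1 g2 => ?_) ?_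
      (fun c hc p hp => ?_)⟩
    · rw [hf₅ x (by omega), hf₄ x (by omega), hf₃ x (by omega), hf₂ x (by omega), gf x hx]
    · rw [hA₅, if_neg (by omega), hA₄, if_neg (by omega), hA₃, if_neg (by omega), hA₂,
        if_neg (by omega), gA, if_neg g1]
    · simp [hA₅, hA₄, hA₃, hA₂, gA]
    · have : 4 * i ≠ 4 * i + 2 + 1 := by omega
      interval_cases c <;> interval_cases p <;> simpa [hA₅, hA₄, hA₃, hA₂, this]

theorem run_buildTables (D : Describes B E m M) (hW : 8 * (M + 4) ≤ 2 ^ w) {s : State}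
    (h0 : s.reg 0 = m) (hA : s.arr = B) :
    Run w buildTables s fun t s' => t ≤ 1010 * m + 10 ∧ (∀ x < 20, s'.reg x = s.reg x) ∧
      Tables B s'.arr E m := by
  have hw : w ≠ 0 := by rintro rfl; omega
  have hm := D.size_le
  refine .seq (.assign (by simp [Expr.Fits]) ?_)
  have key : ∀ d i (s₁ : State), d = m - i → i ≤ m → s₁.reg 24 = i →
      (∀ x < 24, s₁.reg x = s.reg x) → Tables B s₁.arr E i →
      Run w (.loop (.lt (.var 24) (.var 0)) (.seq tableEntry
        (.assign 24 (.add (.var 24) (.const 1))))) s₁ fun t s' =>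
          t ≤ 1010 * (m - i) + 4 ∧ (∀ x < 24, s'.reg x = s.reg x) ∧ Tables B s'.arr E m := by
    intro d
    induction d with
    | zero =>
      intro i s₁ hd hi h24 hf hT
      obtain rfl : i = m := by omega
      refine .loop ?_ (fun h => ?_) (fun h => ⟨by simp [Expr.cost], hf, hT⟩)
      · simp [Expr.Fits, h24, hf, h0]
        omega
      · simp [Expr.eval, h24, hf, h0] at h
    | succ d ih =>
      intro i s₁ hd hi h24 hf hT
      refine .loop ?_ (fun h => ?_) (fun h => ?_)
      · simp [Expr.Fits, h24, hf, h0]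
        omega
      · refine .seq ((run_tableEntry D hW (by omega) h24 hT).mono ?_)
        rintro t s₂ ⟨g1, g2, g3⟩
        refine .assign (by simp [Expr.Fits, Expr.eval, g2, h24]; omega) ?_
        simp only [Expr.eval, g2, h24, Nat.reduceLT]
        refine (ih (i + 1) (s₂.setReg 24 (i + 1)) (by omega) (by omega) (by simp)
          (fun x hx => ?_) g3).mono ?_
        · simp [show x ≠ 24 by omega, g2 x (by omega), hf x hx]
        · rintro t' s' ⟨f1, f2, f3⟩
          refine ⟨?_, f2, f3⟩
          simp only [Expr.cost]
          omega
      · simp [Expr.eval, h24, hf, h0] at h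
        omega
  refine (key m 0 _ rfl (by omega) (by simp [Expr.eval])
    (fun x hx => by simp [show x ≠ 24 by omega])
    ⟨fun a _ => by simp [hA], fun x hx => by omega, fun x hx => by omega⟩).mono ?_
  rintro t s' ⟨f1, f2, f3⟩
  refine ⟨?_, fun x hx => f2 x (by omega), f3⟩
  simp only [Expr.cost]
  omega

end WordRAM

/-! ### Search in the derivation tree -/

namespace WordRAM

variable {w m M : ℕ} {B : ℕ → ℕ → ℕ} {E : ℕ → List Bool}

/-- One step down the derivation tree, from the nonterminal in register `24`, whose string starts
behind the index in register `25`: to the part that contains the index in register `20`. If this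
is the left part, then the first suitable index in the right part becomes the candidate in
register `26`. -/
def descendStep : Prog :=
  .seq (.assign 27 (.add (.var 25) (.get 3 (.get 1 (.var 24))))) <|
  .ite (.lt (.var 27) (.var 20))
    (.seq (.assign 25 (.var 27)) (.assign 24 (.get 2 (.var 24)))) <|
  .seq (.assign 28 (.get 4 (tableAddr (.get 2 (.var 24)) (.var 22)
    (Expr.mod2 (.add (.var 20) (.var 27)))))) <|
  .seq (.ite (.var 28) (.assign 26 (.add (.var 27) (.var 28))) .skip)
    (.assign 24 (.get 1 (.var 24)))

/-- Search with step `2` in the string derived from the last nonterminal. -/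
def descend : Prog :=
  .seq (.assign 24 (.sub (.var 0) (.const 1))) <|
  .seq (.assign 25 (.const 0)) <|
  .seq (.assign 26 (.add (.get 3 (.var 24)) (.const 1))) <|
  .seq (.loop (.lt (.const 1) (.get 0 (.var 24))) descendStep) <|
  .seq (.ite (.add (.sub (.var 22) (.get 0 (.var 24))) (.sub (.get 0 (.var 24)) (.var 22)))
    .skip (.assign 26 (.var 20))) <|
  .assign 23 (.var 26)

/-- The state of the descent at the nonterminal `v`, whose string occupies the indices
`base + 1, …` of the string `W` and contains the index `a`: the candidate `r` is the first
suitable index behind that string. -/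
structure Descent (E : ℕ → List Bool) (W : List Bool) (c a b v base r : ℕ) : Prop where
  lt : base < a
  le : a ≤ base + (E v).length
  le_length : base + (E v).length ≤ W.length
  sub : ∀ q, 1 ≤ q → q ≤ (E v).length → bitAt W (base + q) = bitAt (E v) q
  none : ∀ x, base + (E v).length < x → x < r → x ≤ b → x % 2 = a % 2 → bitAt W x ≠ c
  hit : r ≤ b → bitAt W r = c ∧ r % 2 = a % 2
  cand_gt : base + (E v).length < r
  cand_le : r ≤ W.length + 1

theorem Descent.right {W : List Bool} {c a b v base r j k : ℕ}
    (h : Descent E W c a b v base r) (hE : E v = E j ++ E k) (ha : base + (E j).length < a) :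
    Descent E W c a b k (base + (E j).length) r := by
  obtain ⟨h1, h2, h3, h4, h5, h6, h7, h8⟩ := h
  rw [hE, List.length_append, ← add_assoc] at h2 h3 h5 h7
  refine ⟨ha, h2, h3, fun q g1 g2 => ?_, h5, h6, h7, h8⟩
  rw [add_assoc, h4 _ (by omega) (by rw [hE, List.length_append]; omega), hE,
    bitAt_append_right g1]

theorem Descent.left {W : List Bool} {c a b v base r j k f : ℕ}
    (h : Descent E W c a b v base r) (hE : E v = E j ++ E k) (ha : a ≤ base + (E j).length)
    (hf : FirstAt (E k) c ((a + (base + (E j).length)) % 2) f) :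
    Descent E W c a b j base (if f = 0 then r else base + (E j).length + f) := by
  obtain ⟨h1, h2, h3, h4, h5, h6, h7, h8⟩ := h
  have hlen : (E v).length = (E j).length + (E k).length := by rw [hE, List.length_append]
  have hr : ∀ q, 1 ≤ q → q ≤ (E k).length →
      bitAt W (base + (E j).length + q) = bitAt (E k) q := fun q g1 g2 => by
    rw [add_assoc, h4 _ (by omega) (by omega), hE, bitAt_append_right g1]
  have hl : ∀ q, 1 ≤ q → q ≤ (E j).length → bitAt W (base + q) = bitAt (E j) q :=
    fun q g1 g2 => by
      rw [h4 q g1 (by omega), hE, bitAt_append_left g2]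
  by_cases hf0 : f = 0
  · rw [if_pos hf0]
    refine ⟨h1, ha, by omega, hl, fun x g1 g2 g3 g4 => ?_, h6, by omega, h8⟩
    rcases Nat.lt_or_ge (base + (E v).length) x with g5 | g5
    · exact h5 x g5 g2 g3 g4
    · rw [show x = base + (E j).length + (x - (base + (E j).length)) by omega,
        hr _ (by omega) (by omega)]
      exact hf.none hf0 _ (by omega) (by omega) (by omega)
  · rw [if_neg hf0]
    obtain ⟨f1, f2, f3, f4⟩ := hf.some hf0
    refine ⟨h1, ha, by omega, hl, fun x g1 g2 g3 g4 => ?_, fun _ => ⟨?_, by omega⟩, by omega,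
      by omega⟩
    · rw [show x = base + (E j).length + (x - (base + (E j).length)) by omega,
        hr _ (by omega) (by omega)]
      exact f4 _ (by omega) (by omega) (by omega)
    · rw [hr _ (by omega) f1, f3]

theorem run_descendLoop (D : Describes B E m M) (hW : 8 * (M + 4) ≤ 2 ^ w) {A : ℕ → ℕ → ℕ}
    (hT : Tables B A E m) {W : List Bool} (hWM : W.length ≤ M) {c a b v base r : ℕ} (hc : c ≤ 1)
    {s : State} (hA : s.arr = A) (hv : v < m) (h : Descent E W c a b v base r)
    (h20 : s.reg 20 = a) (h22 : s.reg 22 = c) (h24 : s.reg 24 = v) (h25 : s.reg 25 = base)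
    (h26 : s.reg 26 = r) :
    Run w (.loop (.lt (.const 1) (.get 0 (.var 24))) descendStep) s fun t s' =>
      s'.arr = A ∧ (∀ x, x < 24 ∨ 28 < x → s'.reg x = s.reg x) ∧ t ≤ 100 * v + 10 ∧
      ∃ v' r', v' < m ∧ s'.reg 24 = v' ∧ s'.reg 26 = r' ∧ Descent E W c a b v' (a - 1) r' ∧
        ∃ d : Bool, B 0 v' = d.toNat ∧ E v' = [d] := by
  have hw : w ≠ 0 := by rintro rfl; omega
  have hm := D.size_le
  have e1 (i c p : ℕ) : i + i + (i + i) + (c + c + p) = 4 * i + 2 * c + p := by ring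
  have hB (a : ℕ) (ha : a < 3) (y : ℕ) : A a y = B a y := by rw [hT.rules a ha]
  have hmod (e : Expr) (s : State) (h : e.Fits w s) (h' : e.eval s < 2 ^ w) :
    e.mod2.Fits w s := Expr.fits_mod2 h h'
  induction v using Nat.strong_induction_on generalizing base r s with
  | _ v ih =>
    have g1 := h.lt
    have g2 := h.le
    have g3 := h.le_length
    have g4 := h.cand_gt
    have g5 := h.cand_le
    rcases D.rule v hv with ⟨d, hd, hE⟩ | ⟨h0, hj, hk, hE⟩
    · have hd1 : d.toNat ≤ 1 := by cases d <;> simp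
      refine .loop ?_ (fun h => ?_) (fun h' => ⟨hA, fun x _ => rfl, by simp [Expr.cost],
        v, r, hv, h24, h26, ?_, d, hd, hE⟩)
      · simp [Expr.Fits, Expr.eval, h24, hA, hB, hd]
        omega
      · simp [Expr.eval, h24, hA, hB, hd] at h
        omega
      · have : (E v).length = 1 := by simp [hE]
        rwa [show a - 1 = base by omega]
    · have lj := hT.length _ (hj.trans hv)
      have lk := hT.length _ (hk.trans hv)
      have hfk := hT.first _ (hk.trans hv) c hc
      generalize hjj : B 1 v = j at *
      generalize hkk : B 2 v = k at *
      have hlen : (E v).length = (E j).length + (E k).length := by rw [hE, List.length_append]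
      refine .loop ?_ (fun _ => .seq (.assign ?_ (.ite ?_ (fun hlt => ?_) (fun hlt => ?_))))
        (fun h' => by simp [Expr.eval, h24, hA, hB, h0] at h')
      · simp [Expr.Fits, Expr.eval, h24, hA, hB, h0]
        omega
      · simp [Expr.Fits, Expr.eval, h24, h25, hA, hB, hjj, lj]
        omega
      · simp [Expr.Fits, Expr.eval, h20, h24, h25, hA, hB, hjj, lj]
        omega
      · simp [Expr.eval, h20, h24, h25, hA, hB, hjj, lj] at hlt
        refine .seq (.assign ?_ (.assign ?_ ?_))
        · simp [Expr.Fits, Expr.eval, h24, h25, hA, hB, hjj, lj]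
          omega
        · simp [Expr.Fits, Expr.eval, h24, hA, hB, hkk]
          omega
        generalize hs₁ : State.setReg _ 24 _ = s₁
        have hf₁ : ∀ x, x < 24 ∨ 28 < x → s₁.reg x = s.reg x := fun x hx => by
          simp [← hs₁, show x ≠ 24 by omega, show x ≠ 25 by omega, show x ≠ 27 by omega]
        refine (ih k hk (by simp [← hs₁, hA]) (hk.trans hv) (h.right hE hlt)
          (by simp [hf₁, h20]) (by simp [hf₁, h22])
          (by simp [← hs₁, Expr.eval, h24, hA, hB, hkk])
          (by simp [← hs₁, Expr.eval, h24, h25, hA, hB, hjj, lj]) (by simp [← hs₁, h26])).mono ?_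
        rintro t s' ⟨f1, f2, f3, f4⟩
        refine ⟨f1, fun x hx => by rw [f2 x hx, hf₁ x hx], ?_, f4⟩
        simp only [Expr.cost]
        omega
      · simp [Expr.eval, h20, h24, h25, hA, hB, hjj, lj] at hlt
        have hf := hfk ((a + (base + (E j).length)) % 2) (by omega)
        have hfl := hf.le
        generalize hff : A 4 (4 * k + 2 * c + (a + (base + (E j).length)) % 2) = f at *
        generalize hs₁ : State.setReg _ 27 _ = s₁
        have hf₁ : ∀ x, x ≠ 27 → s₁.reg x = s.reg x := fun x hx => by simp [← hs₁, hx]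
        have hA₁ : s₁.arr = A := by simp [← hs₁, hA]
        have h27 : s₁.reg 27 = base + (E j).length := by
          simp [← hs₁, Expr.eval, h24, h25, hA, hB, hjj, lj]
        clear hs₁
        refine .seq (.assign ⟨⟨⟨⟨?_, ?_, ?_⟩, ⟨?_, ?_, ?_⟩, ?_⟩, ⟨⟨?_, ?_, ?_⟩, hmod _ _ ?_ ?_, ?_⟩,
          ?_⟩, ?_⟩ ?_)
        iterate 15
          · simp [Expr.Fits, tableAddr, Expr.eval, Expr.eval_mod2, h20, h22, h24, h27, hf₁, hA₁, hB,
              hkk, e1, hff]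
            try omega
        simp only [Expr.eval, tableAddr, Expr.eval_mod2, h20, h22, h24, h27, hf₁, hA₁, hB, hkk, e1,
          hff, ne_eq, Nat.reduceEqDiff, not_false_eq_true, Nat.reduceLT]
        have hstep : Run w (.ite (.var 28) (.assign 26 (.add (.var 27) (.var 28))) .skip)
            (s₁.setReg 28 f) fun t s₂ => t ≤ 10 ∧ s₂.arr = A ∧
              (∀ x, x ≠ 28 → x ≠ 26 → s₂.reg x = s₁.reg x) ∧
              s₂.reg 26 = if f = 0 then r else base + (E j).length + f := by
          refine .ite (by simp [Expr.Fits]; omega) (fun g => .assign ?_ ?_) (fun g => .skip ?_)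
          · simp [Expr.Fits, Expr.eval, h27]
            omega
          · simp [Expr.eval] at g
            refine ⟨by simp [Expr.cost], by simp [hA₁], fun x g1 g2 => by simp [g1, g2], ?_⟩
            simp [Expr.eval, h27, g]
          · simp [Expr.eval] at g
            refine ⟨by simp [Expr.cost], by simp [hA₁], fun x g1 g2 => by simp [g1], ?_⟩
            simp [hf₁, g, h26]
        refine .seq (hstep.mono ?_)
        rintro t₂ s₂ ⟨ht₂, hA₂, hf₂, h26₂⟩
        refine .assign ?_ ?_
        · simp [Expr.Fits, Expr.eval, hf₂, hf₁, h24, hA₂, hB, hjj]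
          omega
        refine (ih j hj (s := State.setReg _ _ _) (by simp [hA₂]) (hj.trans hv)
          (h.left hE hlt hf) (by simp [hf₂, hf₁, h20]) (by simp [hf₂, hf₁, h22])
          (by simp [Expr.eval, hf₂, hf₁, h24, hA₂, hB, hjj])
          (by simp [hf₂, hf₁, h25]) (by simpa using h26₂)).mono ?_
        rintro t s' ⟨f1, f2, f3, f4⟩
        refine ⟨f1, fun x hx => ?_, ?_, f4⟩
        · simp [f2 x hx, show x ≠ 24 by omega, hf₂ x (by omega) (by omega), hf₁ x (by omega)]
        · simp only [Expr.cost, Expr.cost_mod2]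
          omega

theorem run_descend (D : Describes B E m M) (hW : 8 * (M + 4) ≤ 2 ^ w) {A : ℕ → ℕ → ℕ}
    (hT : Tables B A E m) (hm0 : 0 < m) {a b c : ℕ} {s : State} (hA : s.arr = A)
    (h0 : s.reg 0 = m) (h20 : s.reg 20 = a) (h22 : s.reg 22 = c)
    (ha : 1 ≤ a) (hab : a ≤ b) (hb : b ≤ (E (m - 1)).length) (hc : c ≤ 1) :
    Run w descend s fun t s' => s'.arr = A ∧ (∀ x, x < 23 ∨ 28 < x → s'.reg x = s.reg x) ∧
      IsNext (bitAt (E (m - 1))) 2 c a b (s'.reg 23) ∧ s'.reg 23 ≤ (E (m - 1)).length + 1 ∧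
      t ≤ 100 * m + 50 := by
  have hw : w ≠ 0 := by rintro rfl; omega
  have hm := D.size_le
  have hWM := D.length_le (m - 1) (by omega)
  have hB (a : ℕ) (ha : a < 3) (y : ℕ) : A a y = B a y := by rw [hT.rules a ha]
  have hlen := hT.length (m - 1) (by omega)
  refine .seq (.assign ?_ (.seq (.assign ?_ (.seq (.assign ?_ (.seq ?_))))))
  · simp [Expr.Fits, h0]
    omega
  · simp [Expr.Fits]
  · simp [Expr.Fits, Expr.eval, h0, hA, hlen]
    omega
  generalize hs₁ : State.setReg _ 26 _ = s₁
  have hf₁ : ∀ x, x < 23 ∨ 28 < x → s₁.reg x = s.reg x := fun x hx => by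
    simp [← hs₁, show x ≠ 24 by omega, show x ≠ 25 by omega, show x ≠ 26 by omega]
  refine (run_descendLoop D hW hT hWM hc (W := E (m - 1)) (a := a) (b := b)
    (v := m - 1) (base := 0) (r := (E (m - 1)).length + 1)
    (by simp [← hs₁, hA]) (by omega)
    ⟨by omega, by omega, by omega, fun q _ _ => by simp, fun x _ _ _ => by omega, by omega,
      by omega, le_rfl⟩ (by simp [hf₁, h20]) (by simp [hf₁, h22])
    (by simp [← hs₁, Expr.eval, h0]) (by simp [← hs₁, Expr.eval])
    (by simp [← hs₁, Expr.eval, h0, hA, hlen])).mono ?_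
  rintro t s₂ ⟨hA₂, hf₂, ht, v, r, hv, h24, h26, hd, d, hBd, hEd⟩
  have hd1 : d.toNat ≤ 1 := by cases d <;> simp
  obtain ⟨g1, g2, g3, g4, g5, g6, g7, g8⟩ := hd
  have hl : (E v).length = 1 := by simp [hEd]
  rw [hl] at g2 g3 g4 g5 g7
  have hbit : bitAt (E (m - 1)) a = d.toNat := by
    have := g4 1 le_rfl le_rfl
    rwa [hEd, bitAt_singleton, show a - 1 + 1 = a by omega] at this
  have k20 : s₂.reg 20 = a := by simp [hf₂, hf₁, h20]
  have k22 : s₂.reg 22 = c := by simp [hf₂, hf₁, h22]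
  have hfr : ∀ x, x < 23 ∨ 28 < x → s₂.reg x = s.reg x := fun x hx => by
    rw [hf₂ x (by omega), hf₁ x hx]
  refine .seq (.ite ?_ (fun h => .skip (.assign ?_ ?_)) (fun h => .assign ?_ (.assign ?_ ?_)))
  · simp [Expr.Fits, Expr.eval, k22, h24, hA₂, hB, hBd]
    omega
  · simp [Expr.Fits, h26]
    omega
  · simp [Expr.eval, k22, h24, hA₂, hB, hBd] at h
    refine ⟨by simp [hA₂], fun x hx => ?_, ?_, ?_, ?_⟩
    · simp [show x ≠ 23 by omega, hfr x hx]
    · simp only [setReg_reg, if_true, Expr.eval, h26]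
      refine ⟨by omega, fun x f1 f2 f3 f4 => ?_, fun f => g6 f⟩
      rcases Nat.eq_or_lt_of_le f1 with rfl | f5
      · omega
      · exact g5 x (by omega) f2 f3 f4
    · simp [Expr.eval, h26]
      omega
    · simp only [Expr.cost]
      omega
  · simp [Expr.Fits, k20]
    omega
  · simp [Expr.Fits, Expr.eval, k20]
    omega
  · simp [Expr.eval, k22, h24, hA₂, hB, hBd] at h
    refine ⟨by simp [hA₂], fun x hx => ?_, ?_, ?_, ?_⟩
    · simp [show x ≠ 23 by omega, show x ≠ 26 by omega, hfr x hx]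
    · simp only [setReg_reg, if_true, Expr.eval, k20]
      exact ⟨le_rfl, fun x f1 f2 => by omega, fun _ => ⟨by omega, rfl⟩⟩
    · simp [Expr.eval, k20]
      omega
    · simp only [Expr.cost]
      omega

end WordRAM

namespace WordRAM

variable {w m M : ℕ} {B : ℕ → ℕ → ℕ} {E : ℕ → List Bool}

/-- Search with step `1`: the searches with step `2` from two consecutive indices. -/
def descendBoth : Prog :=
  .seq descend <|
  .ite (.lt (.var 20) (.var 21))
    (.seq (.assign 30 (.var 23)) <|
      .seq (.assign 20 (.add (.var 20) (.const 1))) <|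
      .seq descend <|
      .ite (.lt (.var 30) (.var 23)) (.assign 23 (.var 30)) .skip)
    .skip

theorem searches_descend (D : Describes B E m M) (hW : 8 * (M + 4) ≤ 2 ^ w) {A : ℕ → ℕ → ℕ}
    (hT : Tables B A E m) (hm0 : 0 < m) :
    Searches w (E (m - 1)).length m A (bitAt (E (m - 1))) (200 * m + 200) 0 2 descend := by
  intro s hA h0 h1 hab hb hc
  refine (run_descend D hW hT hm0 hA h0 rfl rfl h1 hab hb hc).mono ?_
  rintro t s' ⟨f1, f2, f3, f4, f5⟩
  exact ⟨f1, fun x hx => f2 x (by omega), f3, by omega, by omega⟩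

theorem searches_descendBoth (D : Describes B E m M) (hW : 8 * (M + 4) ≤ 2 ^ w) {A : ℕ → ℕ → ℕ}
    (hT : Tables B A E m) (hm0 : 0 < m) :
    Searches w (E (m - 1)).length m A (bitAt (E (m - 1))) (200 * m + 200) 0 1 descendBoth := by
  intro s hA h0 h1 hab hb hc
  have hw : w ≠ 0 := by rintro rfl; omega
  have hWM := D.length_le (m - 1) (by omega)
  refine .seq ((run_descend D hW hT hm0 hA h0 rfl rfl h1 hab hb hc).mono ?_)
  rintro t₁ s₁ ⟨hA₁, hf₁, hr₁, hn₁, ht₁⟩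
  generalize ha : s.reg 20 = a at *
  generalize hb' : s.reg 21 = b at *
  generalize hc' : s.reg 22 = c at *
  generalize hr : s₁.reg 23 = r at *
  refine .ite ?_ (fun h => ?_) (fun h => .skip ?_)
  · simp [Expr.Fits, hf₁, ha, hb']
    omega
  · simp [Expr.eval, hf₁, ha, hb'] at h
    refine .seq (.assign ?_ (.seq (.assign ?_ (.seq ?_))))
    · simp [Expr.Fits, hr]
      omega
    · simp [Expr.Fits, Expr.eval, hf₁, ha]
      omega
    refine (run_descend D hW hT hm0 (a := a + 1) (b := b) (c := c) (by simp [hA₁])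
      (by simp [hf₁, h0]) (by simp [Expr.eval, hf₁, ha]) (by simp [hf₁, hc']) (by omega)
      (by omega) hb hc).mono ?_
    rintro t₂ s₂ ⟨hA₂, hf₂, hr₂, hn₂, ht₂⟩
    generalize hr' : s₂.reg 23 = r' at *
    have h30 : s₂.reg 30 = r := by simp [hf₂, Expr.eval, hr]
    have hf : ∀ x < 20, s₂.reg x = s.reg x := fun x hx => by
      simp [hf₂ x (by omega), show x ≠ 20 by omega, show x ≠ 30 by omega, hf₁ x (by omega)]
    have l1 := hr₁.le
    have l2 := hr₂.le
    -- the indices from `a` on have the parity of `a` or of `a + 1`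
    have key : ∀ x, a ≤ x → x < r → x < r' → x ≤ b → bitAt (E (m - 1)) x ≠ c := by
      intro x g1 g2 g3 g4
      rcases Nat.mod_two_eq_zero_or_one (x + a) with g5 | g5
      · exact hr₁.none x g1 g2 g4 (by omega)
      · exact hr₂.none x (by omega) g3 g4 (by omega)
    refine .ite ?_ (fun g => .assign ?_ ⟨?_, ?_, ?_, ?_, ?_⟩) (fun g => .skip ⟨hA₂, hf, ?_, ?_, ?_⟩)
    · simp [Expr.Fits, h30, hr']
      omega
    · simp [Expr.Fits, h30]
      omega
    · exact hA₂
    · exact fun x hx => by simp [show x ≠ 23 by omega, hf x hx]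
    · simp [Expr.eval, h30, hr'] at g
      simp only [setReg_reg, if_true, Expr.eval, h30]
      exact ⟨l1, fun x g1 g2 g3 _ => key x g1 g2 (by omega) g3,
        fun g1 => ⟨(hr₁.hit g1).1, by omega⟩⟩
    · simp [Expr.eval, h30]
      omega
    · simp only [Expr.cost]
      omega
    · simp [Expr.eval, h30, hr'] at g
      rw [hr']
      exact ⟨by omega, fun x g1 g2 g3 _ => key x g1 (by omega) g2 g3,
        fun g1 => ⟨(hr₂.hit g1).1, by omega⟩⟩
    · omega
    · simp only [Expr.cost]
      omega
  · simp [Expr.eval, hf₁, ha, hb'] at h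
    refine ⟨hA₁, fun x hx => hf₁ x (by omega), ?_, by omega, ?_⟩
    · rw [hr]
      refine ⟨hr₁.le, fun x g1 g2 g3 _ => hr₁.none x g1 g2 g3 ?_, fun g => ⟨(hr₁.hit g).1, ?_⟩⟩
      · rw [show x = a by omega]
      · omega
    · simp only [Expr.cost]
      omega

end WordRAM

/-! ### Grammar-compressed strings -/

/-- The string derived from `v_i`, and the empty string if there is no such nonterminal. -/
def StraightLineGrammar.expandAt {α : Type*} (G : StraightLineGrammar α) (i : ℕ) : List α :=
  if h : i < G.size then G.expand ⟨i, h⟩ else []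

theorem StraightLineGrammar.expandAt_pred {α : Type*} (G : StraightLineGrammar α) :
    G.expandAt (G.size - 1) = G.word := by
  have := G.size_pos
  simp [expandAt, word, this]

theorem grammar_rule (G : StraightLineGrammar Bool) (I : IntervalPair G.word.length) {i : ℕ}
    (hi : i < G.size) : (∃ b : Bool, (grammarInput G I).arr 0 i = b.toNat ∧ G.expandAt i = [b]) ∨
      ((grammarInput G I).arr 0 i = 2 ∧ (grammarInput G I).arr 1 i < i ∧
        (grammarInput G I).arr 2 i < i ∧ G.expandAt i =
          G.expandAt ((grammarInput G I).arr 1 i) ++ G.expandAt ((grammarInput G I).arr 2 i)) := by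
  have hE : G.expandAt i = G.expand ⟨i, hi⟩ := dif_pos hi
  rw [hE, StraightLineGrammar.expand]
  simp only [grammarInput, dif_pos hi]
  rcases G.rhs ⟨i, hi⟩ with b | ⟨j, k⟩
  · exact .inl ⟨b, by simp, rfl⟩
  · have hj := j.isLt
    have hk := k.isLt
    simp only at hj hk
    exact .inr ⟨by simp, by simp, by simp, by
      simp [StraightLineGrammar.expandAt, hj.trans hi, hk.trans hi]⟩

theorem describes_grammarInput (G : StraightLineGrammar Bool) (I : IntervalPair G.word.length) :
    Describes (grammarInput G I).arr G.expandAt G.size (2 ^ G.size) := by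
  have hlen : ∀ i, i < G.size → (G.expandAt i).length ≤ 2 ^ i := by
    intro i
    induction i using Nat.strong_induction_on with
    | _ i ih =>
      intro hi
      rcases grammar_rule G I hi with ⟨b, -, hE⟩ | ⟨-, hj, hk, hE⟩
      · rw [hE]
        exact Nat.one_le_two_pow
      · obtain ⟨d, rfl⟩ : ∃ d, i = d + 1 := ⟨i - 1, by omega⟩
        have h1 := (ih _ hj (hj.trans hi)).trans
          (Nat.pow_le_pow_right (by simp) (Nat.le_of_lt_succ hj))
        have h2 := (ih _ hk (hk.trans hi)).trans
          (Nat.pow_le_pow_right (by simp) (Nat.le_of_lt_succ hk))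
        rw [hE, List.length_append, pow_succ]
        omega
  exact ⟨fun i hi => grammar_rule G I hi,
    fun i hi => (hlen i hi).trans (Nat.pow_le_pow_right (by simp) hi.le), Nat.lt_two_pow_self.le⟩

/-- The detection algorithm with searches in the derivation tree takes `O(m (m + N))` steps on a
grammar of size `m`, where `N` is the larger quotient of the two lengths. -/
theorem exists_polynomial_prog : ∃ (p : WordRAM.Prog) (c e : ℕ),
    ∀ (G : StraightLineGrammar Bool) (I : IntervalPair G.word.length),
      ∃ T w : ℕ,
        (T : ℝ) ≤ c * ((G.size : ℝ) +
          max ((I.L.card : ℝ) / I.R.card) ((I.R.card : ℝ) / I.L.card)) ^ e ∧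
        (w : ℝ) ≤ c * ((G.size : ℝ) +
          max ((I.L.card : ℝ) / I.R.card) ((I.R.card : ℝ) / I.L.card)) ^ e ∧
        WordRAM.Decides p (grammarInput G I) (HasLRCadence G.word I.L I.R 3) T w := by
  refine ⟨.seq WordRAM.buildTables (WordRAM.detect WordRAM.descendBoth WordRAM.descend),
    50000, 2, fun G I => ?_⟩
  have h1 := I.one_le_lmin
  have h2 := I.lmin_le_lmax
  have h3 := I.lmax_le
  have h4 := I.one_le_rmin
  have h5 := I.rmin_le_rmax
  have h6 := I.rmax_le
  have hm := G.size_pos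
  rw [I.card_L, I.card_R]
  have D := describes_grammarInput G I
  have hW : 8 * (2 ^ G.size + 4) ≤ 2 ^ (G.size + 6) := by
    have := Nat.one_le_two_pow (n := G.size)
    rw [pow_add]
    omega
  obtain ⟨lL, hlL⟩ : ∃ l, l = I.lmax - I.lmin + 1 := ⟨_, rfl⟩
  obtain ⟨lR, hlR⟩ : ∃ l, l = I.rmax - I.rmin + 1 := ⟨_, rfl⟩
  obtain ⟨N, hN⟩ : ∃ N, N = 2 * lR / lL + 2 * lL / lR + 3 := ⟨_, rfl⟩
  have hrun := WordRAM.Run.seq (q := WordRAM.detect WordRAM.descendBoth WordRAM.descend)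
    (Q := fun t s' => (s'.reg 0 ≠ 0 ↔ HasLRCadence G.word I.L I.R 3) ∧
      t ≤ 1010 * G.size + 10 + (N * (4 * (200 * G.size + 200) + 124) +
        16 * (200 * G.size + 200) + 820))
    ((WordRAM.run_buildTables D hW (s := grammarInput G I) rfl rfl).mono fun t s hs => by
      obtain ⟨ht, hf, hT⟩ := hs
      have hO : WordRAM.Oracles (G.size + 6) G.word.length G.size s.arr (bitAt G.word)
          (200 * G.size + 200) 0 WordRAM.descendBoth WordRAM.descend := by
        have g1 := WordRAM.searches_descend D hW hT hm
        have g2 := WordRAM.searches_descendBoth D hW hT hm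
        have g3 := D.length_le (G.size - 1) (by omega)
        rw [G.expandAt_pred] at g1 g2 g3
        exact ⟨g2, g1, bitAt_le _, by omega⟩
      refine (WordRAM.run_detect hO h1 h2 h3 h4 h5 h6 (N := N)
        (fun k hk => ?_) (fun k hk => ?_) rfl (hf 0 (by simp)) (hf 1 (by simp)) (hf 2 (by simp))
        (hf 3 (by simp)) (hf 4 (by simp)) (hf 9 (by simp))).mono ?_
      · rw [← hlL, ← hlR] at hk
        exact hN ▸ (le_of_mul_le_length (by omega) hk).trans (by gcongr; exact Nat.le_add_right _ _)
      · rw [← hlL, ← hlR] at hk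
        exact hN ▸ (le_of_mul_le_length (by omega) hk).trans (by gcongr; exact Nat.le_add_left _ _)
      · rintro t' s' ⟨g1, g2⟩
        rw [g1, hasLRCadence_iff]
        refine ⟨Iff.rfl, ?_⟩
        rw [zero_mul] at g2
        omega)
  obtain ⟨t, s', hex, hans, ht⟩ := hrun
  obtain ⟨ρ, hρ⟩ : ∃ ρ, ρ = max ((lL : ℝ) / lR) ((lR : ℝ) / lL) := ⟨_, rfl⟩
  have hL0 : (0 : ℝ) < lL := by exact_mod_cast (by omega : 0 < lL)
  have hR0 : (0 : ℝ) < lR := by exact_mod_cast (by omega : 0 < lR)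
  have hρ1 : 1 ≤ ρ := by
    rw [hρ, le_max_iff]
    rcases le_total lL lR with h | h
    · exact .inr ((one_le_div hL0).mpr (by exact_mod_cast h))
    · exact .inl ((one_le_div hR0).mpr (by exact_mod_cast h))
  have hNρ : (N : ℝ) ≤ 7 * ρ := by
    have g1 : ((2 * lR / lL : ℕ) : ℝ) ≤ 2 * ρ := by
      refine Nat.cast_div_le.trans ?_
      push_cast
      rw [mul_div_assoc, hρ]
      exact mul_le_mul_of_nonneg_left (le_max_right _ _) (by norm_num)
    have g2 : ((2 * lL / lR : ℕ) : ℝ) ≤ 2 * ρ := by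
      refine Nat.cast_div_le.trans ?_
      push_cast
      rw [mul_div_assoc, hρ]
      exact mul_le_mul_of_nonneg_left (le_max_left _ _) (by norm_num)
    rw [hN, Nat.cast_add, Nat.cast_add]
    push_cast at g1 g2 ⊢
    linarith
  have hm1 : (1 : ℝ) ≤ G.size := by exact_mod_cast hm
  rw [← hlL, ← hlR, ← hρ]
  refine ⟨t, G.size + 6, ?_, ?_, t, s', hex, le_rfl, hans⟩
  · have ht' : (t : ℝ) ≤ 1010 * G.size + 10 + (N * (4 * (200 * G.size + 200) + 124) +
        16 * (200 * G.size + 200) + 820) := by exact_mod_cast ht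
    have hNm : (N : ℝ) * (4 * (200 * G.size + 200) + 124) ≤
        7 * ρ * (4 * (200 * G.size + 200) + 124) :=
      mul_le_mul_of_nonneg_right hNρ (by positivity)
    norm_num
    nlinarith [mul_nonneg (sub_nonneg.mpr hm1) (sub_nonneg.mpr hρ1)]
  · push_cast
    nlinarith [mul_nonneg (sub_nonneg.mpr hm1) (sub_nonneg.mpr hρ1)]

theorem mainTheorem5 :
    -- compressed strings: steps and word length polynomial in the compressed size and the ratio
    (∃ (p : WordRAM.Prog) (c e : ℕ),
      ∀ (G : StraightLineGrammar Bool) (I : IntervalPair G.word.length),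
        ∃ T w : ℕ,
          (T : ℝ) ≤ c * ((G.size : ℝ) +
            max ((I.L.card : ℝ) / I.R.card) ((I.R.card : ℝ) / I.L.card)) ^ e ∧
          (w : ℝ) ≤ c * ((G.size : ℝ) +
            max ((I.L.card : ℝ) / I.R.card) ((I.R.card : ℝ) / I.L.card)) ^ e ∧
          WordRAM.Decides p (grammarInput G I) (HasLRCadence G.word I.L I.R 3) T w) ∧
    -- uncompressed strings: linearly many steps on words of logarithmic length
    (∃ (p : WordRAM.Prog) (c : ℕ),
      ∀ (S : List Bool) (I : IntervalPair S.length),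
        WordRAM.Decides p (stringInput S I) (HasLRCadence S I.L I.R 3)
          (c * (I.L.card + I.R.card)) (c * (Nat.log 2 S.length + 1))) :=
  ⟨exists_polynomial_prog, exists_linear_prog⟩
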